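/- **Theorem 3.1.** Let $X,Y$ be real Hilbert spaces, let $\mathcal A:D(\mathcal A)\to X$ be a self-adjoint positive operator with $\mathcal A^{-1}$ compact in $X$, and let $\mathcal B:Y\to X$ be a bounded linear operator. *Spaces.* For $s\ge 0$ let $X_s=D(\mathcal A^s)$ with norm $\|x\|_{X_s}=\|\mathcal A^s x\|_X$, and let $X_{-s}$ be the dual of $X_s$ with respect to the pivot space $X$. Put $V=X_{1/2}=D(\mathcal A^{1/2})$ and $H=V\times X$ with $\|(w,v)\|_H^2=\|\mathcal A^{1/2}w\|_X^2+\|v\|_X^2$. Let $A(w,v)=(v,-\mathcal A w)$ on $D(A)=D(\mathcal A)\times V$, with $\|(w,v)\|_{D(A)}^2=\|\mathcal A w\|_X^2+\|\mathcal A^{1/2}v\|_X^2$, and let $By=(0,\mathcal B y)$, $B^*(w,v)=\mathcal B^*v$. The norm of a product space is given by the sum of the squares of the norms of the components. *Schemes.* For a time step $\Delta t>0$ consider the damped scheme $$\frac{\tilde z^{k+1}-z^k}{\Delta t}=A\Big(\frac{z^k+\tilde z^{k+1}}2\Big)-BB^*\Big(\frac{z^k+\tilde z^{k+1}}2\Big),\qquad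 \frac{z^{k+1}-\tilde z^{k+1}}{\Delta t}=(\Delta t)^2A^2z^{k+1},\qquad k\in\mathbb N, \tag{9}$$ with energy $E^k=\frac12\|z^k\|_H^2$, and the conservative scheme with numerical viscosity $$\frac{\tilde u^{k+1}-u^k}{\Delta t}=A\Big(\frac{u^k+\tilde u^{k+1}}2\Big),\qquad \frac{u^{k+1}-\tilde u^{k+1}}{\Delta t}=(\Delta t)^2A^2u^{k+1},\qquad k\in\mathbb N. \tag{12}$$ *Assumption.* Let $T>0$, $c>0$ and $\beta>-\frac12$ be such that for every $0<\Delta t<1$ every solution of (12) with $u^0\in D(A)$ satisfies $$c\,\|u^0\|^2_{X_{-\beta}\times X_{-\beta-1/2}}\le \Delta t\sum_{k\Delta t\in[0,T]}\Big\|B^*\Big(\frac{u^k+\tilde u^{k+1}}2\Big)\Big\|_Y^2+\Delta t\sum_{k\Delta t\in[0,T]}(\Delta t)^2\|Au^{k+1}\|_H^2+\Delta t\sum_{k\Delta t\in[0,T]}(\Delta t)^5\|A^2u^{k+1}\|_H^2, \tag{13}$$ where $k$ runs over the integers $k\ge0$ with $k\Delta t\in[0,T]$ (and $c,T,\beta$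 do not depend on $\Delta t$). *Conclusion.* There exists $M>0$ such that for every $0<\Delta t<1$, every solution of (9) with $z^0\in D(A)$ and every $k\ge 0$, with $t_k=k\Delta t$, $$E^k\le \frac{M}{(1+t_k)^{\frac1{1+2\beta}}}\,\|z^0\|_{D(A)}^2 .$$ -/

import Mathlib

namespace ViscousScheme

noncomputable section

variable {X Y : Type*} [NormedAddCommGroup X] [InnerProductSpace ℝ X] [CompleteSpace X]
  [NormedAddCommGroup Y] [InnerProductSpace ℝ Y] [CompleteSpace Y]

/-! ### The unbounded operator, its fractional powers and the scale of spaces it generates -/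

/-- `𝒜` is a self-adjoint (hence densely defined) positive operator whose inverse exists, is
defined on all of `X`, and is a compact operator. -/
structure IsPositiveCompactInverse (𝒜 : X →ₗ.[ℝ] X) : Prop where
  isSelfAdjoint : IsSelfAdjoint 𝒜
  pos : ∀ x : 𝒜.domain, x ≠ 0 → 0 < inner ℝ (𝒜 x) (x : X)
  exists_inverse : ∃ R : X →L[ℝ] X, IsCompactOperator R ∧
    (∀ x : X, ∃ h : R x ∈ 𝒜.domain, 𝒜 ⟨R x, h⟩ = x) ∧ ∀ x : 𝒜.domain, R (𝒜 x) = x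

open Classical in
/-- The value `T x` of a partially defined operator, with the value `0` off the domain. It is only
used together with the information that `x` lies in the domain. -/
def app (T : X →ₗ.[ℝ] X) (x : X) : X := if h : x ∈ T.domain then T ⟨x, h⟩ else 0

/-- The eigenspace `{x ∈ D(𝒜) : 𝒜 x = η x}`. -/
def eigenspace (𝒜 : X →ₗ.[ℝ] X) (η : ℝ) : Submodule ℝ X where
  carrier := {x | ∃ h : x ∈ 𝒜.domain, 𝒜 ⟨x, h⟩ = η • x}
  add_mem' := by
    rintro x y ⟨hx, ex⟩ ⟨hy, ey⟩
    refine ⟨𝒜.domain.add_mem hx hy, ?_⟩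
    have h := 𝒜.map_add ⟨x, hx⟩ ⟨y, hy⟩
    rw [ex, ey, ← smul_add] at h
    exact h
  zero_mem' := by
    refine ⟨𝒜.domain.zero_mem, ?_⟩
    have h := 𝒜.map_zero
    rw [smul_zero]
    exact h
  smul_mem' := by
    rintro c x ⟨hx, ex⟩
    refine ⟨𝒜.domain.smul_mem c hx, ?_⟩
    have h := 𝒜.map_smul c ⟨x, hx⟩
    rw [ex, smul_comm] at h
    exact h

/-- The orthogonal projection of `X` onto the eigenspace of `𝒜` for `η`; it is `0` unless `η` is an
eigenvalue. (The eigenspace of a self-adjoint operator is closed, so the closure changes nothing.) -/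
def eigenProj (𝒜 : X →ₗ.[ℝ] X) (η : ℝ) : X →L[ℝ] X :=
  (eigenspace 𝒜 η).topologicalClosure.starProjection

/-- The domain `D(𝒜^s)` of the real power `𝒜^s`: the vectors `x` for which the spectral expansion
`∑ η, η^s P_η x` converges in `X`, the sum being over the eigenvalues `η` of `𝒜`. -/
def powDomain (𝒜 : X →ₗ.[ℝ] X) (s : ℝ) : Submodule ℝ X where
  carrier := {x | Summable fun η : ℝ => (η ^ s) • eigenProj 𝒜 η x}
  add_mem' := by
    intro x y hx hy
    simpa only [Set.mem_ofPred_eq, map_add, smul_add] using Summable.add hx hy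
  zero_mem' := by
    simpa only [Set.mem_ofPred_eq, map_zero, smul_zero] using
      (summable_zero : Summable fun _ : ℝ => (0 : X))
  smul_mem' := by
    intro c x hx
    simpa only [Set.mem_ofPred_eq, map_smul, smul_comm _ c] using Summable.const_smul c hx

/-- The value `𝒜^s x = ∑ η, η^s P_η x`, meaningful for `x ∈ D(𝒜^s)`. -/
def powApp (𝒜 : X →ₗ.[ℝ] X) (s : ℝ) (x : X) : X :=
  ∑' η : ℝ, (η ^ s) • eigenProj 𝒜 η x

/-- The norm of `X_s` at `x`. For `s ≥ 0` the space `X_s` is `D(𝒜^s)` with the norm `‖𝒜^s x‖`. For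
`s < 0` it is the dual of `X_{-s} = D(𝒜^{-s})` with pivot space `X`, so that the norm of `x ∈ X` is
that of the functional `y ↦ ⟨x, y⟩` on `D(𝒜^{-s})`. -/
def scaleNorm (𝒜 : X →ₗ.[ℝ] X) (s : ℝ) (x : X) : ℝ :=
  if 0 ≤ s then ‖powApp 𝒜 s x‖
  else sSup {r : ℝ | ∃ y ∈ powDomain 𝒜 (-s), ‖powApp 𝒜 (-s) y‖ ≤ 1 ∧ r = |inner ℝ x y|}

/-- The square of the norm of `X_s × X_r` at the pair `z`. -/
def pairNormSq (𝒜 : X →ₗ.[ℝ] X) (s r : ℝ) (z : X × X) : ℝ :=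
  scaleNorm 𝒜 s z.1 ^ 2 + scaleNorm 𝒜 r z.2 ^ 2

/-! ### The first order system -/

/-- The energy space `H = V × X` with `V = D(𝒜^{1/2})`. -/
def energySpace (𝒜 : X →ₗ.[ℝ] X) : Submodule ℝ (X × X) := (powDomain 𝒜 (1 / 2)).prod ⊤

/-- `‖(w, v)‖_H ^ 2 = ‖𝒜^{1/2} w‖ ^ 2 + ‖v‖ ^ 2`. -/
def energyNormSq (𝒜 : X →ₗ.[ℝ] X) (z : X × X) : ℝ :=
  ‖powApp 𝒜 (1 / 2) z.1‖ ^ 2 + ‖z.2‖ ^ 2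

/-- `D(A) = D(𝒜) × V`. -/
def waveDomain (𝒜 : X →ₗ.[ℝ] X) : Submodule ℝ (X × X) :=
  𝒜.domain.prod (powDomain 𝒜 (1 / 2))

/-- `A (w, v) = (v, -𝒜 w)`, for `(w, v) ∈ D(A)`. -/
def waveOp (𝒜 : X →ₗ.[ℝ] X) (z : X × X) : X × X := (z.2, -app 𝒜 z.1)

/-- The square of the norm of `D(A) = D(𝒜) × V`, namely `‖𝒜 w‖ ^ 2 + ‖𝒜^{1/2} v‖ ^ 2`. -/
def waveDomainNormSq (𝒜 : X →ₗ.[ℝ] X) (z : X × X) : ℝ :=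
  ‖app 𝒜 z.1‖ ^ 2 + ‖powApp 𝒜 (1 / 2) z.2‖ ^ 2

/-- `B y = (0, 𝓑 y)`. -/
def ctrl (𝓑 : Y →L[ℝ] X) (y : Y) : X × X := (0, 𝓑 y)

/-- `B^* (w, v) = 𝓑^* v`. -/
def obs (𝓑 : Y →L[ℝ] X) (z : X × X) : Y := ContinuousLinearMap.adjoint 𝓑 z.2

/-- The midpoint `(z + z') / 2`. -/
def mid (z z' : X × X) : X × X := (1 / 2 : ℝ) • (z + z')

/-! ### The two schemes -/

/-- The viscosity half step from `zt` to `z'`: `(z' - zt) / τ = τ ^ 2 A ^ 2 z'` with `z' ∈ D(A²)`. -/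
structure IsViscosityStep (𝒜 : X →ₗ.[ℝ] X) (τ : ℝ) (zt z' : X × X) : Prop where
  mem : z' ∈ waveDomain 𝒜
  mem_sq : waveOp 𝒜 z' ∈ waveDomain 𝒜
  eq : τ⁻¹ • (z' - zt) = τ ^ 2 • waveOp 𝒜 (waveOp 𝒜 z')

/-- `(z k)`, with the intermediate states `zt (k + 1)`, solves the damped scheme with numerical
viscosity and time step `τ`:
`(zt (k+1) - z k) / τ = (A - B B^*) ((z k + zt (k+1)) / 2)`,
`(z (k+1) - zt (k+1)) / τ = τ ^ 2 A ^ 2 z (k+1)`. The value `zt 0` plays no role. -/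
structure IsDampedSolution (𝒜 : X →ₗ.[ℝ] X) (𝓑 : Y →L[ℝ] X) (τ : ℝ) (z zt : ℕ → X × X) :
    Prop where
  mem : ∀ k, z k ∈ energySpace 𝒜
  mid_mem : ∀ k, mid (z k) (zt (k + 1)) ∈ waveDomain 𝒜
  midpoint_step : ∀ k, τ⁻¹ • (zt (k + 1) - z k) =
    waveOp 𝒜 (mid (z k) (zt (k + 1))) - ctrl 𝓑 (obs 𝓑 (mid (z k) (zt (k + 1))))
  viscosity_step : ∀ k, IsViscosityStep 𝒜 τ (zt (k + 1)) (z (k + 1))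

/-- `(u k)`, with the intermediate states `ut (k + 1)`, solves the conservative scheme with
numerical viscosity and time step `τ`: the same scheme without the damping term. -/
structure IsConservativeSolution (𝒜 : X →ₗ.[ℝ] X) (τ : ℝ) (u ut : ℕ → X × X) : Prop where
  mem : ∀ k, u k ∈ energySpace 𝒜
  mid_mem : ∀ k, mid (u k) (ut (k + 1)) ∈ waveDomain 𝒜
  midpoint_step : ∀ k, τ⁻¹ • (ut (k + 1) - u k) = waveOp 𝒜 (mid (u k) (ut (k + 1)))
  viscosity_step : ∀ k, IsViscosityStep 𝒜 τ (ut (k + 1)) (u (k + 1))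

/-- The discrete energy `E = ‖z‖_H ^ 2 / 2`. -/
def energy (𝒜 : X →ₗ.[ℝ] X) (z : X × X) : ℝ := 1 / 2 * energyNormSq 𝒜 z

/-- The observability inequality with time `T`, constant `c` and exponent `β`, for one solution of
the conservative scheme. For `0 < τ` and `0 ≤ T`, the indices `k` with `k τ ∈ [0, T]` are exactly
those of `Finset.range (⌊T / τ⌋₊ + 1)`. -/
def WeakObservability (𝒜 : X →ₗ.[ℝ] X) (𝓑 : Y →L[ℝ] X) (T c β τ : ℝ) (u ut : ℕ → X × X) : Prop :=
  c * pairNormSq 𝒜 (-β) (-β - 1 / 2) (u 0) ≤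
    τ * ∑ k ∈ Finset.range (⌊T / τ⌋₊ + 1), ‖obs 𝓑 (mid (u k) (ut (k + 1)))‖ ^ 2
    + τ * ∑ k ∈ Finset.range (⌊T / τ⌋₊ + 1), τ ^ 2 * energyNormSq 𝒜 (waveOp 𝒜 (u (k + 1)))
    + τ * ∑ k ∈ Finset.range (⌊T / τ⌋₊ + 1),
        τ ^ 5 * energyNormSq 𝒜 (waveOp 𝒜 (waveOp 𝒜 (u (k + 1))))

end

end ViscousScheme

set_option linter.unusedSectionVars false

/-! The proof interpolates mode by mode between the weak norm that observability controls and a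
bound in the norm of `D(A)`, then turns the result into a difference inequality for the energy.

Expand in the eigenspaces of `𝒜`. At an eigenvalue `η`, the squared weak norm is `η ^ (-(1 + 2β))`
times the modal energy and the squared `D(A)` norm is `η` times it. Cutting at a level `R` bounds
the energy by `R ^ (1 + 2β)` times the weak norm plus `R⁻¹` times the `D(A)` norm
(`IsForcedStep.energyNormSq_le`).

The weak norm is bounded by the energy lost over a window of length `T`: the damped solution is the
conservative solution with the same data plus a solution with zero data forced by `B B^*`, and the
latter is controlled by the dissipation (`forced_energy_le`, `IsDampedSolution.pairNormSq_le`).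

The `D(A)` norm need not decrease, since `B B^*` need not commute with `A`. The increments do have
decreasing energy, because they solve the same linear scheme (`IsDampedSolution.diff`). For `τ ^ 2 η
≤ 1` the increment and the forcing bound the state in `D(A)` (`IsForcedStep.modeEnergy_le`). For `τ
^ 2 η > 1` the viscous term `τ ^ 2 ‖A z‖ ^ 2` bounds the energy; it is controlled only after
averaging over a window.

With `x m` the energy after `m` double windows, `α = 1 + 2β` and `D` the squared initial `D(A)`
norm, this gives `x (m+1) ≤ a (R ^ α + 1) (x m - x (m+1)) + a D / R` for all `R > 0`
(`exists_difference_inequality`). Choosing `R` proportional to `D / x (m+1)` yields the rate `m ^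
(-1/α)` (`exists_decay_constant`). -/

namespace ViscousScheme

noncomputable section

variable {X Y : Type*} [NormedAddCommGroup X] [InnerProductSpace ℝ X] [CompleteSpace X]
  [NormedAddCommGroup Y] [InnerProductSpace ℝ Y] [CompleteSpace Y]

/-! ### The operator and its inverse -/

theorem app_of_mem {T : X →ₗ.[ℝ] X} {x : X} (hx : x ∈ T.domain) : app T x = T ⟨x, hx⟩ :=
  dif_pos hx

theorem app_add {T : X →ₗ.[ℝ] X} {x y : X} (hx : x ∈ T.domain) (hy : y ∈ T.domain) :
    app T (x + y) = app T x + app T y := by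
  rw [app_of_mem hx, app_of_mem hy, app_of_mem (T.domain.add_mem hx hy), ← T.map_add]
  rfl

theorem app_smul {T : X →ₗ.[ℝ] X} (r : ℝ) {x : X} (hx : x ∈ T.domain) :
    app T (r • x) = r • app T x := by
  rw [app_of_mem hx, app_of_mem (T.domain.smul_mem r hx), ← T.map_smul]
  rfl

variable {𝒜 : X →ₗ.[ℝ] X} (h : IsPositiveCompactInverse 𝒜)

include h

theorem inner_app_left {x y : X} (hx : x ∈ 𝒜.domain) (hy : y ∈ 𝒜.domain) :
    inner ℝ (app 𝒜 x) y = inner ℝ x (app 𝒜 y) := by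
  have key := LinearPMap.adjoint_isFormalAdjoint h.isSelfAdjoint.dense_domain
  rw [LinearPMap.isSelfAdjoint_def.1 h.isSelfAdjoint] at key
  rw [app_of_mem hx, app_of_mem hy]
  exact key ⟨x, hx⟩ ⟨y, hy⟩

/-- The bounded inverse of the operator. -/
def inverse : X →L[ℝ] X := h.exists_inverse.choose

theorem isCompactOperator_inverse : IsCompactOperator (inverse h) := h.exists_inverse.choose_spec.1

theorem inverse_mem (x : X) : inverse h x ∈ 𝒜.domain := (h.exists_inverse.choose_spec.2.1 x).1

theorem app_inverse (x : X) : app 𝒜 (inverse h x) = x := by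
  rw [app_of_mem (inverse_mem h x)]
  exact (h.exists_inverse.choose_spec.2.1 x).2

theorem inverse_app {x : X} (hx : x ∈ 𝒜.domain) : inverse h (app 𝒜 x) = x := by
  rw [app_of_mem hx]
  exact h.exists_inverse.choose_spec.2.2 ⟨x, hx⟩

theorem inner_inverse_left (x y : X) : inner ℝ (inverse h x) y = inner ℝ x (inverse h y) := by
  have := inner_app_left h (inverse_mem h x) (inverse_mem h y)
  rw [app_inverse, app_inverse] at this
  exact this.symm

theorem inner_app_self_nonneg {x : X} (hx : x ∈ 𝒜.domain) : 0 ≤ inner ℝ (app 𝒜 x) x := by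
  by_cases h0 : x = 0
  · simp [h0]
  · rw [app_of_mem hx]
    exact (h.pos ⟨x, hx⟩ fun e => h0 (congrArg Subtype.val e)).le

theorem inner_inverse_self_nonneg (x : X) : 0 ≤ inner ℝ (inverse h x) x := by
  have := inner_app_self_nonneg h (inverse_mem h x)
  rwa [app_inverse, real_inner_comm] at this

/-- The operator `1 + κ 𝒜` is onto for `κ > 0`. -/
theorem exists_add_smul_app_eq {κ : ℝ} (hκ : 0 < κ) (x : X) :
    ∃ y ∈ 𝒜.domain, y + κ • app 𝒜 y = x := by
  -- Put `y = R v` with `R` the bounded inverse: the equation becomes `(R + κ) v = x`, solvable by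
  -- Lax–Milgram because `R ≥ 0`.
  let B : X →L[ℝ] X →L[ℝ] ℝ :=
    (innerSL ℝ).comp (inverse h + κ • ContinuousLinearMap.id ℝ X)
  have hB : ∀ v w, B v w = inner ℝ (inverse h v + κ • v) w := fun _ _ => rfl
  have hco : IsCoercive B := ⟨κ, hκ, fun v => by
    rw [hB, inner_add_left, inner_smul_left, real_inner_self_eq_norm_sq]
    have := inner_inverse_self_nonneg h v
    simp only [conj_trivial]
    nlinarith⟩
  obtain ⟨v, hv⟩ := hco.continuousLinearEquivOfBilin.surjective x
  have hv' : inverse h v + κ • v = x := by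
    refine ext_inner_right ℝ fun w => ?_
    rw [← hB, ← hv, hco.continuousLinearEquivOfBilin_apply]
  exact ⟨inverse h v, inverse_mem h v, by rw [app_inverse, hv']⟩

/-! ### Eigenspaces and the spectral expansion -/

omit h in
theorem mem_eigenspace {η : ℝ} {x : X} :
    x ∈ eigenspace 𝒜 η ↔ x ∈ 𝒜.domain ∧ app 𝒜 x = η • x := by
  constructor
  · rintro ⟨hx, e⟩
    exact ⟨hx, by rw [app_of_mem hx, e]⟩
  · rintro ⟨hx, e⟩
    exact ⟨hx, by rw [← app_of_mem hx, e]⟩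

/-- Positivity of `𝒜`. This makes sums over all real `η` harmless: the conventional values of `η ^
s` at `η ≤ 0` always multiply a zero projection. -/
theorem eigenspace_eq_bot {η : ℝ} (hη : η ≤ 0) : eigenspace 𝒜 η = ⊥ := by
  rw [eq_bot_iff]
  intro x hx
  obtain ⟨hd, e⟩ := mem_eigenspace.1 hx
  by_contra hne
  have h0 : (⟨x, hd⟩ : 𝒜.domain) ≠ 0 := fun e => hne (congrArg Subtype.val e)
  have hp := h.pos _ h0
  rw [← app_of_mem hd, e, inner_smul_left, real_inner_self_eq_norm_sq] at hp
  simp only [conj_trivial] at hp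
  nlinarith [sq_nonneg ‖x‖]

theorem eigenspace_inverse {η : ℝ} (hη : η ≠ 0) :
    eigenspace 𝒜 η = Module.End.eigenspace (inverse h : X →ₗ[ℝ] X) η⁻¹ := by
  ext x
  rw [mem_eigenspace, Module.End.mem_eigenspace_iff, ContinuousLinearMap.coe_coe]
  constructor
  · rintro ⟨hd, e⟩
    have := inverse_app h hd
    rw [e, map_smul] at this
    rw [eq_inv_smul_iff₀ hη, this]
  · intro e
    have hd : x ∈ 𝒜.domain := by
      have := 𝒜.domain.smul_mem η (inverse_mem h x)
      rwa [e, smul_inv_smul₀ hη] at this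
    refine ⟨hd, ?_⟩
    have := app_inverse h x
    rw [e, app_smul _ hd] at this
    rwa [← inv_smul_eq_iff₀ hη]

theorem isClosed_eigenspace (η : ℝ) : IsClosed (eigenspace 𝒜 η : Set X) := by
  rcases le_or_gt η 0 with hη | hη
  · rw [eigenspace_eq_bot h hη]
    exact isClosed_singleton
  · have : (eigenspace 𝒜 η : Set X) = {x | inverse h x = η⁻¹ • x} := by
      ext x
      rw [eigenspace_inverse h hη.ne', SetLike.mem_coe, Module.End.mem_eigenspace_iff]
      rfl
    rw [this]
    exact isClosed_eq (by fun_prop) (by fun_prop)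

theorem topologicalClosure_eigenspace (η : ℝ) :
    (eigenspace 𝒜 η).topologicalClosure = eigenspace 𝒜 η :=
  (isClosed_eigenspace h η).submodule_topologicalClosure_eq

theorem eigenProj_mem (η : ℝ) (x : X) : eigenProj 𝒜 η x ∈ eigenspace 𝒜 η := by
  have : eigenProj 𝒜 η x ∈ (eigenspace 𝒜 η).topologicalClosure :=
    Submodule.starProjection_apply_mem _ _
  rwa [topologicalClosure_eigenspace h] at this

omit h in
theorem eigenProj_of_mem {η : ℝ} {x : X} (hx : x ∈ eigenspace 𝒜 η) : eigenProj 𝒜 η x = x :=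
  Submodule.starProjection_eq_self_iff.2 (Submodule.le_topologicalClosure _ hx)

omit h in
theorem inner_eigenProj_left (η : ℝ) (x y : X) :
    inner ℝ (eigenProj 𝒜 η x) y = inner ℝ x (eigenProj 𝒜 η y) :=
  Submodule.inner_starProjection_left_eq_right _ _ _

theorem orthogonalFamily_eigenspace :
    OrthogonalFamily ℝ (fun η : ℝ => eigenspace 𝒜 η) fun η => (eigenspace 𝒜 η).subtypeₗᵢ := by
  intro η θ hne x y
  obtain ⟨hx, ex⟩ := mem_eigenspace.1 x.2
  obtain ⟨hy, ey⟩ := mem_eigenspace.1 y.2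
  have := inner_app_left h hx hy
  rw [ex, ey, inner_smul_left, inner_smul_right] at this
  have h2 : (η - θ) * inner ℝ (x : X) (y : X) = 0 := by
    simp only [conj_trivial] at this
    linarith
  exact (mul_eq_zero.1 h2).resolve_left (sub_ne_zero.2 hne)

theorem inner_eq_zero_of_mem_eigenspace {η θ : ℝ} (hne : η ≠ θ) {x y : X}
    (hx : x ∈ eigenspace 𝒜 η) (hy : y ∈ eigenspace 𝒜 θ) : inner ℝ x y = 0 :=
  orthogonalFamily_eigenspace h hne ⟨x, hx⟩ ⟨y, hy⟩

theorem eigenProj_eq_zero_of_mem {η θ : ℝ} (hne : η ≠ θ) {x : X} (hx : x ∈ eigenspace 𝒜 η) :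
    eigenProj 𝒜 θ x = 0 := by
  have : inner ℝ (eigenProj 𝒜 θ x) (eigenProj 𝒜 θ x) = (0 : ℝ) := by
    rw [inner_eigenProj_left, eigenProj_of_mem (eigenProj_mem h θ x)]
    exact inner_eq_zero_of_mem_eigenspace h hne hx (eigenProj_mem h θ x)
  exact inner_self_eq_zero.1 this

theorem norm_sum_sq_of_mem_eigenspace {f : ℝ → X} (hf : ∀ η, f η ∈ eigenspace 𝒜 η)
    (F : Finset ℝ) : ‖∑ η ∈ F, f η‖ ^ 2 = ∑ η ∈ F, ‖f η‖ ^ 2 :=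
  (orthogonalFamily_eigenspace h).norm_sum (fun η => (⟨f η, hf η⟩ : eigenspace 𝒜 η)) F

theorem summable_iff_of_mem_eigenspace {f : ℝ → X} (hf : ∀ η, f η ∈ eigenspace 𝒜 η) :
    Summable f ↔ Summable fun η => ‖f η‖ ^ 2 :=
  (orthogonalFamily_eigenspace h).summable_iff_norm_sq_summable
    (fun η => (⟨f η, hf η⟩ : eigenspace 𝒜 η))

theorem hasSum_norm_sq_of_mem_eigenspace {f : ℝ → X} (hf : ∀ η, f η ∈ eigenspace 𝒜 η)
    {x : X} (hx : HasSum f x) : HasSum (fun η => ‖f η‖ ^ 2) (‖x‖ ^ 2) := by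
  have h1 : Filter.Tendsto (fun F : Finset ℝ => ‖∑ η ∈ F, f η‖ ^ 2) Filter.atTop
      (nhds (‖x‖ ^ 2)) := (Filter.Tendsto.norm hx).pow 2
  simp only [norm_sum_sq_of_mem_eigenspace h hf] at h1
  exact h1

theorem eigenProj_of_hasSum {f : ℝ → X} (hf : ∀ η, f η ∈ eigenspace 𝒜 η)
    {x : X} (hx : HasSum f x) (η : ℝ) : eigenProj 𝒜 η x = f η := by
  have h1 := (eigenProj 𝒜 η).hasSum hx
  have h2 := hasSum_single (f := fun θ => eigenProj 𝒜 η (f θ)) η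
    fun θ hθ => eigenProj_eq_zero_of_mem h hθ (hf θ)
  rw [eigenProj_of_mem (hf η)] at h2
  exact h1.unique h2

theorem sum_norm_eigenProj_sq_le (F : Finset ℝ) (x : X) :
    ∑ η ∈ F, ‖eigenProj 𝒜 η x‖ ^ 2 ≤ ‖x‖ ^ 2 := by
  have e1 := norm_sum_sq_of_mem_eigenspace h (fun η => eigenProj_mem h η x) F
  have e2 : inner ℝ (∑ η ∈ F, eigenProj 𝒜 η x) x = ∑ η ∈ F, ‖eigenProj 𝒜 η x‖ ^ 2 := by
    rw [sum_inner]
    refine Finset.sum_congr rfl fun η _ => ?_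
    rw [← real_inner_self_eq_norm_sq, inner_eigenProj_left η x (eigenProj 𝒜 η x),
      eigenProj_of_mem (eigenProj_mem h η x), inner_eigenProj_left]
  have e3 := real_inner_le_norm (∑ η ∈ F, eigenProj 𝒜 η x) x
  rw [e2, ← e1] at e3
  rw [← e1]
  nlinarith [norm_nonneg (∑ η ∈ F, eigenProj 𝒜 η x), norm_nonneg x,
    sq_nonneg (‖∑ η ∈ F, eigenProj 𝒜 η x‖ - ‖x‖)]

theorem summable_norm_eigenProj_sq (x : X) : Summable fun η : ℝ => ‖eigenProj 𝒜 η x‖ ^ 2 :=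
  summable_of_sum_le (fun _ => sq_nonneg _) fun F => sum_norm_eigenProj_sq_le h F x

/-- The spectral theorem for the compact self-adjoint inverse. Its kernel is trivial, and its other
eigenspaces are those of `𝒜` at the reciprocal eigenvalue. -/
theorem eq_zero_of_eigenProj_eq_zero {x : X} (hx : ∀ η, eigenProj 𝒜 η x = 0) : x = 0 := by
  have hbot := ContinuousLinearMap.orthogonalComplement_iSup_eigenspaces_eq_bot
    (isCompactOperator_inverse h) (fun x y => inner_inverse_left h x y)
  have hmem : x ∈ (⨆ μ, Module.End.eigenspace (inverse h : X →ₗ[ℝ] X) μ)ᗮ := by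
    rw [← Submodule.iInf_orthogonal, Submodule.mem_iInf]
    intro μ
    rw [Submodule.mem_orthogonal]
    intro u hu
    by_cases hμ : μ = 0
    · rw [hμ, Module.End.mem_eigenspace_iff, zero_smul] at hu
      have := app_inverse h u
      rw [ContinuousLinearMap.coe_coe] at hu
      rw [hu] at this
      have h0 : app 𝒜 0 = 0 := by simpa using app_smul (0 : ℝ) 𝒜.domain.zero_mem
      rw [← this, h0, inner_zero_left]
    · have e := eigenspace_inverse h (inv_ne_zero hμ)
      rw [inv_inv] at e
      rw [← e] at hu
      rw [← eigenProj_of_mem hu, inner_eigenProj_left, hx, inner_zero_right]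
  rw [hbot] at hmem
  exact hmem

theorem hasSum_eigenProj (x : X) : HasSum (fun η => eigenProj 𝒜 η x) x := by
  obtain ⟨y, hy⟩ := (summable_iff_of_mem_eigenspace h fun η => eigenProj_mem h η x).2
    (summable_norm_eigenProj_sq h x)
  have : x - y = 0 := eq_zero_of_eigenProj_eq_zero h fun η => by
    rw [map_sub, eigenProj_of_hasSum h (fun η => eigenProj_mem h η x) hy, sub_self]
  rw [← sub_eq_zero.1 this] at hy
  exact hy

theorem hasSum_norm_eigenProj_sq (x : X) :
    HasSum (fun η => ‖eigenProj 𝒜 η x‖ ^ 2) (‖x‖ ^ 2) :=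
  hasSum_norm_sq_of_mem_eigenspace h (fun η => eigenProj_mem h η x) (hasSum_eigenProj h x)

theorem eigenProj_of_nonpos {η : ℝ} (hη : η ≤ 0) (x : X) : eigenProj 𝒜 η x = 0 := by
  have := eigenProj_mem h η x
  rw [eigenspace_eq_bot h hη] at this
  exact this

theorem eigenProj_app {x : X} (hx : x ∈ 𝒜.domain) (η : ℝ) :
    eigenProj 𝒜 η (app 𝒜 x) = η • eigenProj 𝒜 η x := by
  refine ext_inner_right ℝ fun w => ?_
  obtain ⟨hd, e⟩ := mem_eigenspace.1 (eigenProj_mem h η w)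
  rw [inner_eigenProj_left, inner_app_left h hx hd, e, inner_smul_left, inner_smul_right,
    inner_eigenProj_left]
  rfl

/-- The spectral gap: apply the bounded inverse to an eigenvector. It yields the Poincaré-type
inequalities below. -/
theorem one_le_mul_norm_inverse {η : ℝ} {x : X} (hx : eigenProj 𝒜 η x ≠ 0) :
    1 ≤ η * ‖inverse h‖ := by
  have hη : 0 < η := by
    by_contra hn
    exact hx (eigenProj_of_nonpos h (not_lt.1 hn) x)
  obtain ⟨hd, e⟩ := mem_eigenspace.1 (eigenProj_mem h η x)
  have e1 := inverse_app h hd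
  rw [e, map_smul] at e1
  have e2 := (inverse h).le_opNorm (eigenProj 𝒜 η x)
  have e3 : ‖eigenProj 𝒜 η x‖ = η * ‖inverse h (eigenProj 𝒜 η x)‖ := by
    conv_lhs => rw [← e1, norm_smul, Real.norm_of_nonneg hη.le]
  have e4 := norm_pos_iff.2 hx
  have : 1 * ‖eigenProj 𝒜 η x‖ ≤ η * ‖inverse h‖ * ‖eigenProj 𝒜 η x‖ := by
    rw [one_mul, mul_assoc]
    conv_lhs => rw [e3]
    gcongr
  exact le_of_mul_le_mul_right this e4

/-! ### Fractional powers -/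

theorem norm_rpow_smul_eigenProj_sq (s η : ℝ) (x : X) :
    ‖(η ^ s) • eigenProj 𝒜 η x‖ ^ 2 = η ^ (2 * s) * ‖eigenProj 𝒜 η x‖ ^ 2 := by
  rcases le_or_gt η 0 with hη | hη
  · simp [eigenProj_of_nonpos h hη]
  · rw [norm_smul, mul_pow, Real.norm_of_nonneg (Real.rpow_nonneg hη.le _), ← Real.rpow_natCast,
      ← Real.rpow_mul hη.le]
    norm_num [mul_comm]

theorem mem_powDomain_iff {s : ℝ} {x : X} :
    x ∈ powDomain 𝒜 s ↔ Summable fun η : ℝ => η ^ (2 * s) * ‖eigenProj 𝒜 η x‖ ^ 2 := by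
  simp only [← norm_rpow_smul_eigenProj_sq h]
  exact summable_iff_of_mem_eigenspace h fun η => Submodule.smul_mem _ _ (eigenProj_mem h η x)

theorem eigenProj_powApp {s : ℝ} {x : X} (hx : x ∈ powDomain 𝒜 s) (η : ℝ) :
    eigenProj 𝒜 η (powApp 𝒜 s x) = η ^ s • eigenProj 𝒜 η x :=
  eigenProj_of_hasSum h (fun η => Submodule.smul_mem _ _ (eigenProj_mem h η x))
    (Summable.hasSum hx) η

theorem hasSum_norm_powApp_sq {s : ℝ} {x : X} (hx : x ∈ powDomain 𝒜 s) :
    HasSum (fun η : ℝ => η ^ (2 * s) * ‖eigenProj 𝒜 η x‖ ^ 2) (‖powApp 𝒜 s x‖ ^ 2) := by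
  have := hasSum_norm_eigenProj_sq h (powApp 𝒜 s x)
  simpa only [eigenProj_powApp h hx, norm_rpow_smul_eigenProj_sq h] using this

omit h in
theorem powApp_add {s : ℝ} {x y : X} (hx : x ∈ powDomain 𝒜 s) (hy : y ∈ powDomain 𝒜 s) :
    powApp 𝒜 s (x + y) = powApp 𝒜 s x + powApp 𝒜 s y := by
  simp only [powApp, map_add, smul_add]
  exact Summable.tsum_add hx hy

omit h in
theorem powApp_smul {s : ℝ} (r : ℝ) {x : X} (hx : x ∈ powDomain 𝒜 s) :
    powApp 𝒜 s (r • x) = r • powApp 𝒜 s x := by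
  simp only [powApp, map_smul, smul_comm _ r]
  exact Summable.tsum_const_smul r hx

theorem mem_powDomain_of_le {s r : ℝ} (hs : 0 ≤ s) (hsr : s ≤ r) {x : X}
    (hx : x ∈ powDomain 𝒜 r) : x ∈ powDomain 𝒜 s := by
  rw [mem_powDomain_iff h] at hx ⊢
  refine Summable.of_nonneg_of_le (fun η => ?_) (fun η => ?_)
    ((summable_norm_eigenProj_sq h x).add hx)
  · rcases le_or_gt η 0 with hη | hη
    · simp [eigenProj_of_nonpos h hη]
    · positivity
  · rcases le_or_gt η 0 with hη | hη
    · simp [eigenProj_of_nonpos h hη]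
    · have : η ^ (2 * s) ≤ 1 + η ^ (2 * r) := by
        rcases le_or_gt η 1 with h1 | h1
        · have := Real.rpow_le_one hη.le h1 (by linarith : 0 ≤ 2 * s)
          have := Real.rpow_nonneg hη.le (2 * r)
          linarith
        · have := Real.rpow_le_rpow_of_exponent_le h1.le (by linarith : 2 * s ≤ 2 * r)
          linarith
      nlinarith [sq_nonneg ‖eigenProj 𝒜 η x‖]

theorem domain_le_powDomain_one {x : X} (hx : x ∈ 𝒜.domain) : x ∈ powDomain 𝒜 1 := by
  rw [mem_powDomain_iff h]
  refine (summable_norm_eigenProj_sq h (app 𝒜 x)).congr fun η => ?_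
  rw [eigenProj_app h hx, norm_smul, mul_pow, Real.norm_eq_abs, sq_abs]
  norm_num

theorem domain_le_powDomain_half {x : X} (hx : x ∈ 𝒜.domain) : x ∈ powDomain 𝒜 (1 / 2) :=
  mem_powDomain_of_le h (by norm_num) (by norm_num) (domain_le_powDomain_one h hx)

/-- Compare the two spectral series term by term, using `η ^ (1/2) * η ^ (1/2) = η`. That `y` need
only lie in the form domain is what makes `A` skew on all of `D(A)`. -/
theorem inner_powApp_half {x y : X} (hx : x ∈ 𝒜.domain) (hy : y ∈ powDomain 𝒜 (1 / 2)) :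
    inner ℝ (powApp 𝒜 (1 / 2) x) (powApp 𝒜 (1 / 2) y) = inner ℝ (app 𝒜 x) y := by
  have hG := (innerSL ℝ (powApp 𝒜 (1 / 2) y)).hasSum (hasSum_eigenProj h (powApp 𝒜 (1 / 2) x))
  have hA := (innerSL ℝ y).hasSum (hasSum_eigenProj h (app 𝒜 x))
  simp only [innerSL_apply_apply] at hG hA
  rw [real_inner_comm, real_inner_comm y]
  refine hG.unique (hA.congr_fun ?_)
  intro η
  have e : eigenProj 𝒜 η (eigenProj 𝒜 η x) = eigenProj 𝒜 η x :=
    eigenProj_of_mem (eigenProj_mem h η x)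
  have e2 : inner ℝ (powApp 𝒜 (1 / 2) y) (eigenProj 𝒜 η x)
      = η ^ (1 / 2 : ℝ) * inner ℝ y (eigenProj 𝒜 η x) := by
    rw [← e, ← inner_eigenProj_left, eigenProj_powApp h hy, inner_smul_left,
      inner_eigenProj_left, conj_trivial]
  rw [eigenProj_powApp h (domain_le_powDomain_half h hx), eigenProj_app h hx, inner_smul_right,
    inner_smul_right, e2]
  rcases le_or_gt η 0 with hη | hη
  · simp [eigenProj_of_nonpos h hη]
  · rw [← mul_assoc, ← Real.rpow_add hη]
    norm_num

/-! ### Dual norms of negative order -/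

/-- Without boundedness the real `sSup` would take its default value and bound nothing. The spectral
gap embeds the test space in `X`. -/
theorem bddAbove_dual_pairing {s : ℝ} (hs : s < 0) (x : X) :
    BddAbove {r : ℝ | ∃ y ∈ powDomain 𝒜 (-s), ‖powApp 𝒜 (-s) y‖ ≤ 1 ∧ r = |inner ℝ x y|} := by
  have key : ∀ y ∈ powDomain 𝒜 (-s), ‖powApp 𝒜 (-s) y‖ ≤ 1 →
      ‖y‖ ^ 2 ≤ ‖inverse h‖ ^ (2 * -s) := by
    intro y hy h1
    have hs1 := hasSum_norm_eigenProj_sq h y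
    have hs2 := (hasSum_norm_powApp_sq h hy).mul_left (‖inverse h‖ ^ (2 * -s))
    have := hasSum_le (fun η => ?_) hs1 hs2
    · refine this.trans ?_
      have h0 : 0 ≤ ‖inverse h‖ ^ (2 * -s) := Real.rpow_nonneg (norm_nonneg _) _
      have h2 : ‖powApp 𝒜 (-s) y‖ ^ 2 ≤ 1 := by nlinarith [norm_nonneg (powApp 𝒜 (-s) y)]
      nlinarith
    · by_cases h0 : eigenProj 𝒜 η y = 0
      · simp [h0]
      · have hη : 0 < η := by
          by_contra hn
          exact h0 (eigenProj_of_nonpos h (not_lt.1 hn) y)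
        have h2 := Real.one_le_rpow (one_le_mul_norm_inverse h h0) (by linarith : 0 ≤ 2 * -s)
        rw [Real.mul_rpow hη.le (norm_nonneg _)] at h2
        nlinarith [sq_nonneg ‖eigenProj 𝒜 η y‖]
  refine ⟨‖x‖ * √(‖inverse h‖ ^ (2 * -s)), ?_⟩
  rintro r ⟨y, hy, h1, rfl⟩
  refine (abs_real_inner_le_norm x y).trans ?_
  gcongr
  exact Real.le_sqrt_of_sq_le (key y hy h1)

/-- Every finite part of the spectral expansion is controlled by the norm of `X_s`. -/
theorem sum_rpow_mul_norm_eigenProj_sq_le {s : ℝ} {x : X} (hx : 0 ≤ s → x ∈ powDomain 𝒜 s)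
    (F : Finset ℝ) :
    ∑ η ∈ F, η ^ (2 * s) * ‖eigenProj 𝒜 η x‖ ^ 2 ≤ scaleNorm 𝒜 s x ^ 2 := by
  have hnn : ∀ η : ℝ, 0 ≤ η ^ (2 * s) * ‖eigenProj 𝒜 η x‖ ^ 2 := fun η => by
    rw [← norm_rpow_smul_eigenProj_sq h]
    positivity
  unfold scaleNorm
  split_ifs with hs
  · exact sum_le_hasSum F (fun η _ => hnn η) (hasSum_norm_powApp_sq h (hx hs))
  · rw [not_le] at hs
    set Q := ∑ η ∈ F, η ^ (2 * s) * ‖eigenProj 𝒜 η x‖ ^ 2 with hQ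
    have hQ0 : 0 ≤ Q := Finset.sum_nonneg fun η _ => hnn η
    rcases hQ0.eq_or_lt with h0 | hpos
    · rw [← h0]
      positivity
    -- The extremal test vector: both its pairing with `x` and its squared dual-side norm equal `Q`,
    -- so `y / √Q` is admissible and gives `√Q`.
    set y : X := ∑ η ∈ F, η ^ (2 * s) • eigenProj 𝒜 η x with hy
    let f : ℝ → X := fun η => if η ∈ F then η ^ (2 * s) • eigenProj 𝒜 η x else 0
    have hf : ∀ η, f η ∈ eigenspace 𝒜 η := fun η => by
      simp only [f]
      split_ifs
      · exact Submodule.smul_mem _ _ (eigenProj_mem h η x)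
      · exact zero_mem _
    have hfy : HasSum f y := by
      have : HasSum f (∑ η ∈ F, f η) := hasSum_sum_of_ne_finset_zero fun η hη => if_neg hη
      rwa [Finset.sum_congr rfl (fun η hη => if_pos hη)] at this
    have hproj := eigenProj_of_hasSum h hf hfy
    have hterm : ∀ η ∈ F, η ^ (2 * -s) * ‖eigenProj 𝒜 η y‖ ^ 2
        = η ^ (2 * s) * ‖eigenProj 𝒜 η x‖ ^ 2 := fun η hη => by
      rw [hproj]
      simp only [f, if_pos hη]
      rcases le_or_gt η 0 with h0 | h0
      · simp [eigenProj_of_nonpos h h0]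
      · rw [norm_smul, mul_pow, ← mul_assoc, Real.norm_of_nonneg (Real.rpow_nonneg h0.le _), pow_two,
          ← Real.rpow_add h0, ← Real.rpow_add h0]
        congr 2
        ring
    have hterm0 : ∀ η ∉ F, η ^ (2 * -s) * ‖eigenProj 𝒜 η y‖ ^ 2 = 0 := fun η hη => by
      rw [hproj]
      simp [f, if_neg hη]
    have hsum : HasSum (fun η : ℝ => η ^ (2 * -s) * ‖eigenProj 𝒜 η y‖ ^ 2) Q := by
      have : HasSum (fun η : ℝ => η ^ (2 * -s) * ‖eigenProj 𝒜 η y‖ ^ 2) _ :=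
        hasSum_sum_of_ne_finset_zero hterm0
      rwa [Finset.sum_congr rfl hterm] at this
    have hymem : y ∈ powDomain 𝒜 (-s) := (mem_powDomain_iff h).2 hsum.summable
    have hynorm : ‖powApp 𝒜 (-s) y‖ ^ 2 = Q := (hasSum_norm_powApp_sq h hymem).unique hsum
    have hinner : inner ℝ x y = Q := by
      rw [hy, inner_sum]
      refine Finset.sum_congr rfl fun η _ => ?_
      rw [inner_smul_right, ← real_inner_self_eq_norm_sq, inner_eigenProj_left,
        eigenProj_of_mem (eigenProj_mem h η x)]
    have hle : √Q ≤ sSup {r : ℝ | ∃ y ∈ powDomain 𝒜 (-s), ‖powApp 𝒜 (-s) y‖ ≤ 1 ∧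
        r = |inner ℝ x y|} := by
      refine le_csSup (bddAbove_dual_pairing h hs x)
        ⟨(√Q)⁻¹ • y, Submodule.smul_mem _ _ hymem, ?_, ?_⟩
      · rw [powApp_smul _ hymem, norm_smul, norm_inv, Real.norm_of_nonneg (Real.sqrt_nonneg _),
          ← hynorm, Real.sqrt_sq (norm_nonneg _)]
        exact inv_mul_le_one
      · rw [inner_smul_right, hinner, abs_of_nonneg (by positivity), inv_mul_eq_div,
          Real.div_sqrt]
    calc Q = √Q ^ 2 := (Real.sq_sqrt hQ0).symm
      _ ≤ _ := by gcongr

end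

noncomputable section

variable {X Y : Type*} [NormedAddCommGroup X] [InnerProductSpace ℝ X] [CompleteSpace X]
  [NormedAddCommGroup Y] [InnerProductSpace ℝ Y] [CompleteSpace Y]
  {𝒜 : X →ₗ.[ℝ] X}

/-! ### The energy space as a subspace of a Hilbert space -/

/-- The isometry `(w, v) ↦ (𝒜^{1/2} w, v)` of the energy space into `X × X`. -/
def toEnergy (𝒜 : X →ₗ.[ℝ] X) (z : X × X) : WithLp 2 (X × X) :=
  WithLp.toLp 2 (powApp 𝒜 (1 / 2) z.1, z.2)

theorem norm_toEnergy_sq (z : X × X) : ‖toEnergy 𝒜 z‖ ^ 2 = energyNormSq 𝒜 z :=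
  WithLp.prod_norm_sq_eq_of_L2 _

theorem energyNormSq_nonneg (z : X × X) : 0 ≤ energyNormSq 𝒜 z := by
  rw [← norm_toEnergy_sq]
  positivity

theorem inner_toEnergy (z z' : X × X) : inner ℝ (toEnergy 𝒜 z) (toEnergy 𝒜 z') =
    inner ℝ (powApp 𝒜 (1 / 2) z.1) (powApp 𝒜 (1 / 2) z'.1) + inner ℝ z.2 z'.2 :=
  WithLp.prod_inner_apply _ _

theorem mem_energySpace {z : X × X} : z ∈ energySpace 𝒜 ↔ z.1 ∈ powDomain 𝒜 (1 / 2) := by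
  simp [energySpace, Submodule.mem_prod]

theorem mem_waveDomain {z : X × X} :
    z ∈ waveDomain 𝒜 ↔ z.1 ∈ 𝒜.domain ∧ z.2 ∈ powDomain 𝒜 (1 / 2) :=
  Submodule.mem_prod

theorem toEnergy_add {z z' : X × X} (hz : z ∈ energySpace 𝒜) (hz' : z' ∈ energySpace 𝒜) :
    toEnergy 𝒜 (z + z') = toEnergy 𝒜 z + toEnergy 𝒜 z' := by
  simp only [toEnergy, Prod.fst_add, Prod.snd_add,
    powApp_add (mem_energySpace.1 hz) (mem_energySpace.1 hz')]
  rfl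

theorem toEnergy_smul (r : ℝ) {z : X × X} (hz : z ∈ energySpace 𝒜) :
    toEnergy 𝒜 (r • z) = r • toEnergy 𝒜 z := by
  simp only [toEnergy, Prod.smul_fst, Prod.smul_snd, powApp_smul r (mem_energySpace.1 hz)]
  rfl

theorem toEnergy_sub {z z' : X × X} (hz : z ∈ energySpace 𝒜) (hz' : z' ∈ energySpace 𝒜) :
    toEnergy 𝒜 (z - z') = toEnergy 𝒜 z - toEnergy 𝒜 z' := by
  have := toEnergy_add hz (Submodule.smul_mem _ (-1 : ℝ) hz')
  rw [toEnergy_smul _ hz'] at this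
  simpa only [neg_one_smul, ← sub_eq_add_neg] using this

theorem energyNormSq_smul (r : ℝ) {z : X × X} (hz : z ∈ energySpace 𝒜) :
    energyNormSq 𝒜 (r • z) = r ^ 2 * energyNormSq 𝒜 z := by
  rw [← norm_toEnergy_sq, ← norm_toEnergy_sq, toEnergy_smul r hz, norm_smul, mul_pow,
    Real.norm_eq_abs, sq_abs]

theorem waveOp_mem {z : X × X} (hz : z ∈ waveDomain 𝒜) : waveOp 𝒜 z ∈ energySpace 𝒜 :=
  mem_energySpace.2 (mem_waveDomain.1 hz).2

theorem waveOp_add {z z' : X × X} (hz : z ∈ waveDomain 𝒜) (hz' : z' ∈ waveDomain 𝒜) :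
    waveOp 𝒜 (z + z') = waveOp 𝒜 z + waveOp 𝒜 z' := by
  simp only [waveOp, Prod.fst_add, Prod.snd_add, Prod.mk_add_mk,
    app_add (mem_waveDomain.1 hz).1 (mem_waveDomain.1 hz').1, neg_add]

theorem waveOp_smul (r : ℝ) {z : X × X} (hz : z ∈ waveDomain 𝒜) :
    waveOp 𝒜 (r • z) = r • waveOp 𝒜 z := by
  simp only [waveOp, Prod.smul_fst, Prod.smul_snd, Prod.smul_mk,
    app_smul r (mem_waveDomain.1 hz).1, smul_neg]

theorem waveOp_sub {z z' : X × X} (hz : z ∈ waveDomain 𝒜) (hz' : z' ∈ waveDomain 𝒜) :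
    waveOp 𝒜 (z - z') = waveOp 𝒜 z - waveOp 𝒜 z' := by
  have := waveOp_add hz (Submodule.smul_mem _ (-1 : ℝ) hz')
  rw [waveOp_smul _ hz'] at this
  simpa only [neg_one_smul, ← sub_eq_add_neg] using this

theorem waveDomainNormSq_eq (z : X × X) :
    waveDomainNormSq 𝒜 z = energyNormSq 𝒜 (waveOp 𝒜 z) := by
  simp only [waveDomainNormSq, energyNormSq, waveOp, norm_neg]
  ring

theorem ctrl_mem (𝓑 : Y →L[ℝ] X) (y : Y) : ctrl 𝓑 y ∈ energySpace 𝒜 :=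
  mem_energySpace.2 (Submodule.zero_mem _)

theorem inner_toEnergy_ctrl (𝓑 : Y →L[ℝ] X) (y : Y) (z : X × X) :
    inner ℝ (toEnergy 𝒜 (ctrl 𝓑 y)) (toEnergy 𝒜 z) = inner ℝ y (obs 𝓑 z) := by
  rw [inner_toEnergy]
  simp [ctrl, obs, powApp, ContinuousLinearMap.adjoint_inner_right]

theorem norm_toEnergy_ctrl_le (𝓑 : Y →L[ℝ] X) (y : Y) :
    ‖toEnergy 𝒜 (ctrl 𝓑 y)‖ ≤ ‖𝓑‖ * ‖y‖ := by
  have h1 : ‖toEnergy 𝒜 (ctrl 𝓑 y)‖ ^ 2 = ‖𝓑 y‖ ^ 2 := by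
    simp [norm_toEnergy_sq, energyNormSq, ctrl, powApp]
  rw [(sq_eq_sq₀ (norm_nonneg _) (norm_nonneg _)).1 h1]
  exact 𝓑.le_opNorm y

theorem obs_sub (𝓑 : Y →L[ℝ] X) (z z' : X × X) :
    obs 𝓑 (z - z') = obs 𝓑 z - obs 𝓑 z' :=
  map_sub _ _ _

theorem ctrl_sub (𝓑 : Y →L[ℝ] X) (y y' : Y) : ctrl 𝓑 (y - y') = ctrl 𝓑 y - ctrl 𝓑 y' := by
  simp [ctrl]

theorem norm_snd_le_toEnergy (z : X × X) : ‖z.2‖ ≤ ‖toEnergy 𝒜 z‖ := by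
  refine (sq_le_sq₀ (norm_nonneg _) (norm_nonneg _)).1 ?_
  rw [norm_toEnergy_sq, energyNormSq]
  nlinarith [sq_nonneg ‖powApp 𝒜 (1 / 2) z.1‖]

theorem norm_obs_le (𝓑 : Y →L[ℝ] X) (z : X × X) : ‖obs 𝓑 z‖ ≤ ‖𝓑‖ * ‖toEnergy 𝒜 z‖ := by
  refine ((ContinuousLinearMap.adjoint 𝓑).le_opNorm z.2).trans ?_
  rw [LinearIsometryEquiv.norm_map]
  gcongr
  exact norm_snd_le_toEnergy z

theorem mid_sub (z zt w wt : X × X) : mid (z - w) (zt - wt) = mid z zt - mid w wt := by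
  simp only [mid, ← smul_sub]
  congr 1
  abel

section

variable (h : IsPositiveCompactInverse 𝒜)

include h

theorem waveDomain_le {z : X × X} (hz : z ∈ waveDomain 𝒜) : z ∈ energySpace 𝒜 :=
  mem_energySpace.2 (domain_le_powDomain_half h (mem_waveDomain.1 hz).1)

theorem inner_waveOp_left {z z' : X × X} (hz : z ∈ waveDomain 𝒜) (hz' : z' ∈ waveDomain 𝒜) :
    inner ℝ (toEnergy 𝒜 (waveOp 𝒜 z)) (toEnergy 𝒜 z') =
      -inner ℝ (toEnergy 𝒜 z) (toEnergy 𝒜 (waveOp 𝒜 z')) := by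
  rw [mem_waveDomain] at hz hz'
  simp only [inner_toEnergy, waveOp, inner_neg_left, inner_neg_right]
  rw [inner_powApp_half h hz.1 hz'.2, real_inner_comm, inner_powApp_half h hz'.1 hz.2,
    real_inner_comm z.2]
  ring

theorem inner_waveOp_self {z : X × X} (hz : z ∈ waveDomain 𝒜) :
    inner ℝ (toEnergy 𝒜 (waveOp 𝒜 z)) (toEnergy 𝒜 z) = 0 := by
  have := inner_waveOp_left h hz hz
  rw [real_inner_comm (toEnergy 𝒜 (waveOp 𝒜 z))] at this
  linarith

/-! ### One step of the schemes -/

omit h in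
theorem IsViscosityStep.eq_sub {τ : ℝ} (hτ : 0 < τ) {zt z' : X × X}
    (H : IsViscosityStep 𝒜 τ zt z') : zt = z' - τ ^ 3 • waveOp 𝒜 (waveOp 𝒜 z') := by
  have e := H.eq
  rw [inv_smul_eq_iff₀ hτ.ne', smul_smul] at e
  rw [eq_sub_iff_add_eq, ← eq_sub_iff_add_eq', e, ← pow_succ']

omit h in
theorem IsViscosityStep.sub {τ : ℝ} {zt z' wt w' : X × X}
    (H : IsViscosityStep 𝒜 τ zt z') (H' : IsViscosityStep 𝒜 τ wt w') :
    IsViscosityStep 𝒜 τ (zt - wt) (z' - w') := by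
  refine ⟨Submodule.sub_mem _ H.mem H'.mem, ?_, ?_⟩
  · rw [waveOp_sub H.mem H'.mem]
    exact Submodule.sub_mem _ H.mem_sq H'.mem_sq
  · rw [waveOp_sub H.mem H'.mem, waveOp_sub H.mem_sq H'.mem_sq, smul_sub (τ ^ 2), ← H.eq, ← H'.eq,
      ← smul_sub]
    congr 1
    abel

/-- One step from `z` to `z'`, through `zt`, of the scheme with viscosity and a forcing term `f`. -/
structure IsForcedStep (𝒜 : X →ₗ.[ℝ] X) (τ : ℝ) (f z zt z' : X × X) : Prop where
  forcing_mem : f ∈ energySpace 𝒜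
  mem : z ∈ energySpace 𝒜
  mid_mem : mid z zt ∈ waveDomain 𝒜
  midpoint_step : τ⁻¹ • (zt - z) = waveOp 𝒜 (mid z zt) - f
  viscosity_step : IsViscosityStep 𝒜 τ zt z'

omit h in
theorem IsForcedStep.sub {τ : ℝ} {f z zt z' g w wt w' : X × X} (H : IsForcedStep 𝒜 τ f z zt z')
    (H' : IsForcedStep 𝒜 τ g w wt w') :
    IsForcedStep 𝒜 τ (f - g) (z - w) (zt - wt) (z' - w') := by
  refine ⟨Submodule.sub_mem _ H.forcing_mem H'.forcing_mem, Submodule.sub_mem _ H.mem H'.mem, ?_, ?_,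
    H.viscosity_step.sub H'.viscosity_step⟩
  · rw [mid_sub]
    exact Submodule.sub_mem _ H.mid_mem H'.mid_mem
  · have e1 := H.midpoint_step
    have e2 := H'.midpoint_step
    rw [mid_sub, waveOp_sub H.mid_mem H'.mid_mem,
      show zt - wt - (z - w) = (zt - z) - (wt - w) by abel, smul_sub, e1, e2]
    abel

omit h in
theorem IsForcedStep.eq_add {τ : ℝ} (hτ : 0 < τ) {f z zt z' : X × X}
    (H : IsForcedStep 𝒜 τ f z zt z') : zt = z + τ • (waveOp 𝒜 (mid z zt) - f) := by
  rw [← H.midpoint_step, smul_inv_smul₀ hτ.ne']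
  abel

omit h in
theorem IsForcedStep.mem_tilde {τ : ℝ} (hτ : 0 < τ) {f z zt z' : X × X}
    (H : IsForcedStep 𝒜 τ f z zt z') : zt ∈ energySpace 𝒜 := by
  rw [H.eq_add hτ]
  exact Submodule.add_mem _ H.mem (Submodule.smul_mem _ _
    (Submodule.sub_mem _ (waveOp_mem H.mid_mem) H.forcing_mem))

/-- The energy identity for the viscosity half step. -/
theorem IsViscosityStep.energy_eq {τ : ℝ} (hτ : 0 < τ) {zt z' : X × X}
    (H : IsViscosityStep 𝒜 τ zt z') :
    energyNormSq 𝒜 zt = energyNormSq 𝒜 z' + 2 * τ ^ 3 * energyNormSq 𝒜 (waveOp 𝒜 z')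
      + τ ^ 6 * energyNormSq 𝒜 (waveOp 𝒜 (waveOp 𝒜 z')) := by
  have hA2 := waveOp_mem H.mem_sq
  have e1 := inner_waveOp_left h H.mem_sq H.mem
  simp only [← norm_toEnergy_sq]
  conv_lhs => rw [H.eq_sub hτ]
  rw [toEnergy_sub (waveDomain_le h H.mem) (Submodule.smul_mem _ _ hA2), toEnergy_smul _ hA2,
    norm_sub_sq_real, real_inner_smul_right, norm_smul, real_inner_comm, e1,
    real_inner_self_eq_norm_sq, Real.norm_of_nonneg (by positivity)]
  ring

/-- The energy identity for one step of the forced scheme. -/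
theorem IsForcedStep.energy_eq {τ : ℝ} (hτ : 0 < τ) {f z zt z' : X × X}
    (H : IsForcedStep 𝒜 τ f z zt z') :
    energyNormSq 𝒜 z' + 2 * τ ^ 3 * energyNormSq 𝒜 (waveOp 𝒜 z')
      + τ ^ 6 * energyNormSq 𝒜 (waveOp 𝒜 (waveOp 𝒜 z')) =
    energyNormSq 𝒜 z - 2 * τ * inner ℝ (toEnergy 𝒜 f) (toEnergy 𝒜 (mid z zt)) := by
  rw [← H.viscosity_step.energy_eq h hτ]
  have hA := waveOp_mem H.mid_mem
  have hzt := H.mem_tilde hτ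
  have e1 : toEnergy 𝒜 zt - toEnergy 𝒜 z
      = τ • (toEnergy 𝒜 (waveOp 𝒜 (mid z zt)) - toEnergy 𝒜 f) := by
    rw [← toEnergy_sub hzt H.mem, ← toEnergy_sub hA H.forcing_mem,
      ← toEnergy_smul _ (Submodule.sub_mem _ hA H.forcing_mem), ← H.midpoint_step,
      smul_inv_smul₀ hτ.ne']
  have e2 : toEnergy 𝒜 zt + toEnergy 𝒜 z = (2 : ℝ) • toEnergy 𝒜 (mid z zt) := by
    rw [mid, toEnergy_smul _ (Submodule.add_mem _ H.mem hzt), toEnergy_add H.mem hzt, smul_smul]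
    norm_num
    abel
  -- Test the midpoint step against `zt + z`, twice the midpoint; skewness of `A` leaves only the
  -- forcing.
  have e3 : inner ℝ (toEnergy 𝒜 zt - toEnergy 𝒜 z) (toEnergy 𝒜 zt + toEnergy 𝒜 z)
      = ‖toEnergy 𝒜 zt‖ ^ 2 - ‖toEnergy 𝒜 z‖ ^ 2 := by
    rw [inner_sub_left, inner_add_right, inner_add_right, real_inner_self_eq_norm_sq,
      real_inner_self_eq_norm_sq, real_inner_comm (toEnergy 𝒜 z)]
    ring
  rw [e1, e2, real_inner_smul_left, real_inner_smul_right, inner_sub_left,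
    inner_waveOp_self h H.mid_mem, norm_toEnergy_sq, norm_toEnergy_sq] at e3
  linarith

/-- The midpoint satisfies `m = z + (τ/2)(A m - f)`; pair with `m` and use skewness, then divide by
its norm. -/
theorem IsForcedStep.norm_mid_le {τ : ℝ} (hτ : 0 < τ) {f z zt z' : X × X}
    (H : IsForcedStep 𝒜 τ f z zt z') :
    ‖toEnergy 𝒜 (mid z zt)‖ ≤ ‖toEnergy 𝒜 z‖ + τ / 2 * ‖toEnergy 𝒜 f‖ := by
  have hA := waveOp_mem H.mid_mem
  have e1 : mid z zt = z + (τ / 2) • (waveOp 𝒜 (mid z zt) - f) := by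
    rw [← H.midpoint_step, mid, smul_smul, div_mul_eq_mul_div, mul_inv_cancel₀ hτ.ne']
    module
  have e2 : toEnergy 𝒜 (mid z zt) = toEnergy 𝒜 z
      + (τ / 2) • (toEnergy 𝒜 (waveOp 𝒜 (mid z zt)) - toEnergy 𝒜 f) := by
    have hs := Submodule.sub_mem _ hA H.forcing_mem
    rw [← toEnergy_sub hA H.forcing_mem, ← toEnergy_smul _ hs,
      ← toEnergy_add H.mem (Submodule.smul_mem _ _ hs), ← e1]
  have e3 : ‖toEnergy 𝒜 (mid z zt)‖ ^ 2 = inner ℝ (toEnergy 𝒜 z) (toEnergy 𝒜 (mid z zt))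
      - τ / 2 * inner ℝ (toEnergy 𝒜 f) (toEnergy 𝒜 (mid z zt)) := by
    rw [← real_inner_self_eq_norm_sq]
    conv_lhs => enter [2]; rw [e2]
    rw [inner_add_left, real_inner_smul_left, inner_sub_left, inner_waveOp_self h H.mid_mem]
    ring
  have b1 := real_inner_le_norm (toEnergy 𝒜 z) (toEnergy 𝒜 (mid z zt))
  have b2 := (abs_le.1 (abs_real_inner_le_norm (toEnergy 𝒜 f) (toEnergy 𝒜 (mid z zt)))).1
  rcases (norm_nonneg (toEnergy 𝒜 (mid z zt))).eq_or_lt with h0 | h0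
  · rw [← h0]
    positivity
  · refine le_of_mul_le_mul_right ?_ h0
    nlinarith

/-! ### Existence for the conservative scheme -/

/-- Eliminating the velocity `q` from the midpoint equations leaves `(1 + (τ²/4) 𝒜) m = z.1 + (τ/2)
z.2`. Since `A²` is `-𝒜` on each component, the viscosity step is two equations with `1 + τ³ 𝒜`. -/
theorem exists_conservative_step {τ : ℝ} (hτ : 0 < τ) {z : X × X} (hz : z ∈ energySpace 𝒜) :
    ∃ zt z', IsForcedStep 𝒜 τ 0 z zt z' := by
  rw [mem_energySpace] at hz
  obtain ⟨m, hm, em⟩ := exists_add_smul_app_eq h (κ := τ ^ 2 / 4) (by positivity)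
    (z.1 + (τ / 2) • z.2)
  set q : X := (2 / τ) • (m - z.1) with hq
  have hq' : q ∈ powDomain 𝒜 (1 / 2) :=
    Submodule.smul_mem _ _ (Submodule.sub_mem _ (domain_le_powDomain_half h hm) hz)
  set zt : X × X := (2 : ℝ) • (m, q) - z with hzt
  have hmid : mid z zt = (m, q) := by
    rw [hzt, mid, add_sub_cancel, smul_smul]
    norm_num
  obtain ⟨a, ha, ea⟩ := exists_add_smul_app_eq h (κ := τ ^ 3) (by positivity) zt.1
  obtain ⟨b, hb, eb⟩ := exists_add_smul_app_eq h (κ := τ ^ 3) (by positivity) zt.2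
  have hzt1 : zt.1 ∈ powDomain 𝒜 (1 / 2) :=
    Submodule.sub_mem _ (Submodule.smul_mem _ _ (domain_le_powDomain_half h hm)) hz
  -- Extra regularity needed for `(a, b) ∈ D(A²)`, read off from the equation that `a` solves.
  have haa : -app 𝒜 a ∈ powDomain 𝒜 (1 / 2) := by
    have : app 𝒜 a = (τ ^ 3)⁻¹ • (zt.1 - a) := by
      rw [eq_inv_smul_iff₀ (by positivity), ← ea]
      abel
    rw [this]
    exact Submodule.neg_mem _ (Submodule.smul_mem _ _
      (Submodule.sub_mem _ hzt1 (domain_le_powDomain_half h ha)))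
  refine ⟨zt, (a, b), Submodule.zero_mem _, mem_energySpace.2 hz, ?_, ?_, ?_, ?_, ?_⟩
  · rw [hmid]
    exact mem_waveDomain.2 ⟨hm, hq'⟩
  · rw [hmid, sub_zero, hzt, inv_smul_eq_iff₀ hτ.ne']
    have e2 : z.2 = q + (τ / 2) • app 𝒜 m := by
      have : (2 / τ) • (m + (τ ^ 2 / 4) • app 𝒜 m) = (2 / τ) • (z.1 + (τ / 2) • z.2) := by rw [em]
      rw [hq]
      simp only [smul_add, smul_smul] at this
      rw [show 2 / τ * (τ ^ 2 / 4) = τ / 2 by field_simp; ring,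
        show 2 / τ * (τ / 2) = 1 by field_simp, one_smul] at this
      rw [smul_sub, sub_add_eq_add_sub, this]
      abel
    refine Prod.ext ?_ ?_
    · simp only [waveOp, Prod.fst_sub, Prod.smul_fst]
      rw [hq, smul_smul, mul_div_cancel₀ _ hτ.ne']
      module
    · simp only [waveOp, Prod.snd_sub, Prod.smul_snd]
      rw [e2]
      module
  · exact mem_waveDomain.2 ⟨ha, domain_le_powDomain_half h hb⟩
  · exact mem_waveDomain.2 ⟨hb, haa⟩
  · rw [inv_smul_eq_iff₀ hτ.ne', smul_smul, ← pow_succ']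
    refine Prod.ext ?_ ?_
    · simp only [waveOp, Prod.fst_sub, Prod.smul_fst]
      rw [← ea]
      module
    · simp only [waveOp, Prod.snd_sub, Prod.smul_snd]
      rw [← eb]
      module

theorem exists_conservativeSolution {τ : ℝ} (hτ : 0 < τ) {z : X × X} (hz : z ∈ energySpace 𝒜) :
    ∃ u ut : ℕ → X × X, IsConservativeSolution 𝒜 τ u ut ∧ u 0 = z := by
  choose! t s hs using fun w (hw : w ∈ energySpace 𝒜) => exists_conservative_step h hτ hw
  let u : ℕ → X × X := fun k => s^[k] z
  have hu : ∀ k, u (k + 1) = s (u k) := fun k => Function.iterate_succ_apply' s k z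
  have hmem : ∀ k, u k ∈ energySpace 𝒜 := fun k => by
    induction k with
    | zero => exact hz
    | succ k ih =>
      rw [hu]
      exact waveDomain_le h (hs _ ih).viscosity_step.mem
  -- Truncated subtraction only affects the intermediate state at index `0`, which the scheme never
  -- uses.
  refine ⟨u, fun k => t (u (k - 1)), ⟨hmem, fun k => (hs _ (hmem k)).mid_mem, fun k => ?_,
    fun k => ?_⟩, rfl⟩
  · simpa using (hs _ (hmem k)).midpoint_step
  · rw [hu]
    exact (hs _ (hmem k)).viscosity_step

end

end

noncomputable section

variable {X Y : Type*} [NormedAddCommGroup X] [InnerProductSpace ℝ X] [CompleteSpace X]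
  [NormedAddCommGroup Y] [InnerProductSpace ℝ Y] [CompleteSpace Y]
  {𝒜 : X →ₗ.[ℝ] X} {𝓑 : Y →L[ℝ] X}

/-! ### The damped scheme -/

theorem IsDampedSolution.step {τ : ℝ} {z zt : ℕ → X × X} (H : IsDampedSolution 𝒜 𝓑 τ z zt) (k : ℕ) :
    IsForcedStep 𝒜 τ (ctrl 𝓑 (obs 𝓑 (mid (z k) (zt (k + 1))))) (z k) (zt (k + 1)) (z (k + 1)) :=
  ⟨ctrl_mem _ _, H.mem k, H.mid_mem k, H.midpoint_step k, H.viscosity_step k⟩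

theorem IsConservativeSolution.step {τ : ℝ} {u ut : ℕ → X × X}
    (H : IsConservativeSolution 𝒜 τ u ut) (k : ℕ) :
    IsForcedStep 𝒜 τ 0 (u k) (ut (k + 1)) (u (k + 1)) :=
  ⟨Submodule.zero_mem _, H.mem k, H.mid_mem k, by rw [sub_zero]; exact H.midpoint_step k,
    H.viscosity_step k⟩

theorem IsDampedSolution.shift {τ : ℝ} {z zt : ℕ → X × X} (H : IsDampedSolution 𝒜 𝓑 τ z zt)
    (j : ℕ) : IsDampedSolution 𝒜 𝓑 τ (fun k => z (j + k)) (fun k => zt (j + k)) :=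
  ⟨fun k => H.mem (j + k), fun k => H.mid_mem (j + k), fun k => H.midpoint_step (j + k),
    fun k => H.viscosity_step (j + k)⟩

/-- Linearity and constancy of the scheme in `k`. Energy decay then applies to increments, the
discrete counterpart of differentiating in time. -/
theorem IsDampedSolution.diff {τ : ℝ} {z zt : ℕ → X × X} (H : IsDampedSolution 𝒜 𝓑 τ z zt) :
    IsDampedSolution 𝒜 𝓑 τ (fun k => z (k + 1) - z k) (fun k => zt (k + 1) - zt k) := by
  have S := fun k => (H.step (k + 1)).sub (H.step k)
  refine ⟨fun k => (S k).mem, fun k => (S k).mid_mem, fun k => ?_, fun k => (S k).viscosity_step⟩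
  have := (S k).midpoint_step
  rwa [← ctrl_sub, ← obs_sub, ← mid_sub] at this

variable (h : IsPositiveCompactInverse 𝒜)

include h

theorem IsDampedSolution.energy_eq {τ : ℝ} (hτ : 0 < τ) {z zt : ℕ → X × X}
    (H : IsDampedSolution 𝒜 𝓑 τ z zt) (k : ℕ) :
    energyNormSq 𝒜 (z k) - energyNormSq 𝒜 (z (k + 1)) =
      2 * τ * ‖obs 𝓑 (mid (z k) (zt (k + 1)))‖ ^ 2
      + 2 * τ ^ 3 * energyNormSq 𝒜 (waveOp 𝒜 (z (k + 1)))
      + τ ^ 6 * energyNormSq 𝒜 (waveOp 𝒜 (waveOp 𝒜 (z (k + 1)))) := by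
  have := (H.step k).energy_eq h hτ
  rw [inner_toEnergy_ctrl, real_inner_self_eq_norm_sq] at this
  linarith

theorem IsDampedSolution.antitone {τ : ℝ} (hτ : 0 < τ) {z zt : ℕ → X × X}
    (H : IsDampedSolution 𝒜 𝓑 τ z zt) : Antitone fun k => energyNormSq 𝒜 (z k) := by
  refine antitone_nat_of_succ_le fun k => ?_
  have e := H.energy_eq h hτ k
  have h1 := energyNormSq_nonneg (𝒜 := 𝒜) (waveOp 𝒜 (z (k + 1)))
  have h2 := energyNormSq_nonneg (𝒜 := 𝒜) (waveOp 𝒜 (waveOp 𝒜 (z (k + 1))))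
  have : 0 ≤ 2 * τ * ‖obs 𝓑 (mid (z k) (zt (k + 1)))‖ ^ 2
      + 2 * τ ^ 3 * energyNormSq 𝒜 (waveOp 𝒜 (z (k + 1)))
      + τ ^ 6 * energyNormSq 𝒜 (waveOp 𝒜 (waveOp 𝒜 (z (k + 1)))) := by positivity
  linarith

/-! ### Modes -/

omit h in
/-- The energy of the component of `z` in the eigenspace for `η`. -/
def modeEnergy (𝒜 : X →ₗ.[ℝ] X) (η : ℝ) (z : X × X) : ℝ :=
  η * ‖eigenProj 𝒜 η z.1‖ ^ 2 + ‖eigenProj 𝒜 η z.2‖ ^ 2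

theorem modeEnergy_of_nonpos {η : ℝ} (hη : η ≤ 0) (z : X × X) : modeEnergy 𝒜 η z = 0 := by
  simp [modeEnergy, eigenProj_of_nonpos h hη]

theorem modeEnergy_nonneg (η : ℝ) (z : X × X) : 0 ≤ modeEnergy 𝒜 η z := by
  rcases le_or_gt η 0 with hη | hη
  · rw [modeEnergy_of_nonpos h hη]
  · unfold modeEnergy
    positivity

theorem hasSum_modeEnergy {z : X × X} (hz : z ∈ energySpace 𝒜) :
    HasSum (fun η => modeEnergy 𝒜 η z) (energyNormSq 𝒜 z) := by
  have := (hasSum_norm_powApp_sq h (mem_energySpace.1 hz)).add (hasSum_norm_eigenProj_sq h z.2)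
  norm_num at this
  exact this

theorem sum_modeEnergy_le {z : X × X} (hz : z ∈ energySpace 𝒜) (F : Finset ℝ) :
    ∑ η ∈ F, modeEnergy 𝒜 η z ≤ energyNormSq 𝒜 z :=
  sum_le_hasSum F (fun η _ => modeEnergy_nonneg h η z) (hasSum_modeEnergy h hz)

theorem modeEnergy_waveOp {z : X × X} (hz : z ∈ waveDomain 𝒜) (η : ℝ) :
    modeEnergy 𝒜 η (waveOp 𝒜 z) = η * modeEnergy 𝒜 η z := by
  simp only [modeEnergy, waveOp, map_neg, norm_neg, eigenProj_app h (mem_waveDomain.1 hz).1,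
    norm_smul, mul_pow, Real.norm_eq_abs, sq_abs]
  ring

theorem energyNormSq_le_waveOp {z : X × X} (hz : z ∈ waveDomain 𝒜) :
    energyNormSq 𝒜 z ≤ ‖inverse h‖ * energyNormSq 𝒜 (waveOp 𝒜 z) := by
  refine hasSum_le (fun η => ?_) (hasSum_modeEnergy h (waveDomain_le h hz))
    ((hasSum_modeEnergy h (waveOp_mem hz)).mul_left _)
  rw [modeEnergy_waveOp h hz, ← mul_assoc, mul_comm ‖inverse h‖]
  by_cases h1 : eigenProj 𝒜 η z.1 = 0
  · by_cases h2 : eigenProj 𝒜 η z.2 = 0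
    · simp [modeEnergy, h1, h2]
    · exact le_mul_of_one_le_left (modeEnergy_nonneg h η z) (one_le_mul_norm_inverse h h2)
  · exact le_mul_of_one_le_left (modeEnergy_nonneg h η z) (one_le_mul_norm_inverse h h1)

/-! ### The first increment -/

omit h in
theorem norm_ctrl_obs_le (z : X × X) :
    ‖toEnergy 𝒜 (ctrl 𝓑 (obs 𝓑 z))‖ ≤ ‖𝓑‖ ^ 2 * ‖toEnergy 𝒜 z‖ :=
  calc ‖toEnergy 𝒜 (ctrl 𝓑 (obs 𝓑 z))‖ ≤ ‖𝓑‖ * ‖obs 𝓑 z‖ := norm_toEnergy_ctrl_le _ _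
    _ ≤ ‖𝓑‖ * (‖𝓑‖ * ‖toEnergy 𝒜 z‖) := by
        gcongr
        exact norm_obs_le _ _
    _ = _ := by ring

/-- The viscosity half step moves a state `zt ∈ D(A)` by at most `τ ‖A zt‖`. -/
theorem IsViscosityStep.norm_sub_le {τ : ℝ} (hτ : 0 < τ) (hτ1 : τ < 1) {zt z' : X × X}
    (H : IsViscosityStep 𝒜 τ zt z') (hzt : zt ∈ waveDomain 𝒜) :
    ‖toEnergy 𝒜 z' - toEnergy 𝒜 zt‖ ≤ τ * ‖toEnergy 𝒜 (waveOp 𝒜 zt)‖ := by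
  have hA2 := waveOp_mem H.mem_sq
  have e0 : toEnergy 𝒜 zt = toEnergy 𝒜 z' - τ ^ 3 • toEnergy 𝒜 (waveOp 𝒜 (waveOp 𝒜 z')) := by
    rw [← toEnergy_smul _ hA2, ← toEnergy_sub (waveDomain_le h H.mem) (Submodule.smul_mem _ _ hA2),
      ← H.eq_sub hτ]
  have e1 := inner_waveOp_left h H.mem_sq H.mem
  have e2 := inner_waveOp_left h H.mem_sq hzt
  rw [real_inner_self_eq_norm_sq] at e1
  conv_lhs at e2 => rw [e0]
  rw [inner_sub_right, real_inner_smul_right, real_inner_self_eq_norm_sq, e1] at e2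
  have b := real_inner_le_norm (toEnergy 𝒜 (waveOp 𝒜 z')) (toEnergy 𝒜 (waveOp 𝒜 zt))
  have e3 : ‖toEnergy 𝒜 z' - toEnergy 𝒜 zt‖
      = τ ^ 3 * ‖toEnergy 𝒜 (waveOp 𝒜 (waveOp 𝒜 z'))‖ := by
    rw [e0, sub_sub_cancel, norm_smul, Real.norm_of_nonneg (by positivity)]
  set a := ‖toEnergy 𝒜 (waveOp 𝒜 (waveOp 𝒜 z'))‖
  set p := ‖toEnergy 𝒜 (waveOp 𝒜 z')‖
  set q := ‖toEnergy 𝒜 (waveOp 𝒜 zt)‖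
  have hq : 0 ≤ q := norm_nonneg _
  have ha : 0 ≤ a := norm_nonneg _
  -- Pairing `A² z'` with `zt` in two ways gives `p² + τ³ a² ≤ p q`.
  have key : τ ^ 3 * a ^ 2 ≤ q ^ 2 := by nlinarith [sq_nonneg (p - q / 2), sq_nonneg q]
  rw [e3]
  refine (sq_le_sq₀ (by positivity) (by positivity)).1 ?_
  calc (τ ^ 3 * a) ^ 2 = τ ^ 3 * (τ ^ 3 * a ^ 2) := by ring
    _ ≤ τ ^ 3 * q ^ 2 := by gcongr
    _ ≤ τ ^ 2 * q ^ 2 := by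
        gcongr 1
        exact pow_le_pow_of_le_one hτ.le hτ1.le (by norm_num)
    _ = (τ * q) ^ 2 := by ring

/-- The first increment of the damped scheme is at most `τ` times the norm of the initial state in
`D(A)`. -/
theorem IsDampedSolution.energyNormSq_sub_le {τ : ℝ} (hτ : 0 < τ) (hτ1 : τ < 1) {z zt : ℕ → X × X}
    (H : IsDampedSolution 𝒜 𝓑 τ z zt) (h0 : z 0 ∈ waveDomain 𝒜) :
    energyNormSq 𝒜 (z 1 - z 0) ≤ τ ^ 2 * ((5 + 2 * ‖𝓑‖ ^ 2) * (1 + ‖𝓑‖ ^ 2 * (1 + ‖inverse h‖))) ^ 2 *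
      waveDomainNormSq 𝒜 (z 0) := by
  set b := ‖𝓑‖ ^ 2 with hb
  have hb0 : 0 ≤ b := by positivity
  set m := mid (z 0) (zt 1) with hm
  set g := waveOp 𝒜 m - ctrl 𝓑 (obs 𝓑 m) with hg
  have hmm : m ∈ waveDomain 𝒜 := H.mid_mem 0
  have ezt : zt 1 = z 0 + τ • g := (H.step 0).eq_add hτ
  have hge : g ∈ energySpace 𝒜 := Submodule.sub_mem _ (waveOp_mem hmm) (ctrl_mem _ _)
  have em : m = z 0 + (τ / 2) • g := by
    rw [hm, mid, ezt]
    module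
  -- The slope `g` is a multiple of the difference of two elements of `D(A)`, although `B B^*` need
  -- not preserve `D(A)`.
  have hgd : g ∈ waveDomain 𝒜 := by
    have : g = (2 / τ) • (m - z 0) := by
      rw [em, add_sub_cancel_left, smul_smul, show 2 / τ * (τ / 2) = 1 by field_simp, one_smul]
    rw [this]
    exact Submodule.smul_mem _ _ (Submodule.sub_mem _ hmm h0)
  have hztd : zt 1 ∈ waveDomain 𝒜 := by
    rw [ezt]
    exact Submodule.add_mem _ h0 (Submodule.smul_mem _ _ hgd)
  set G := toEnergy 𝒜 g
  set Z := toEnergy 𝒜 (z 0)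
  set a := toEnergy 𝒜 (waveOp 𝒜 (z 0)) with ha
  have hJg : G = a + (τ / 2) • toEnergy 𝒜 (waveOp 𝒜 g) - toEnergy 𝒜 (ctrl 𝓑 (obs 𝓑 m)) := by
    have : toEnergy 𝒜 (waveOp 𝒜 m) = a + (τ / 2) • toEnergy 𝒜 (waveOp 𝒜 g) := by
      rw [em, waveOp_add h0 (Submodule.smul_mem _ _ hgd), waveOp_smul _ hgd,
        toEnergy_add (waveOp_mem h0) (Submodule.smul_mem _ _ (waveOp_mem hgd)),
        toEnergy_smul _ (waveOp_mem hgd)]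
    rw [← this, ← toEnergy_sub (waveOp_mem hmm) (ctrl_mem _ _)]
  have hobs : obs 𝓑 m = obs 𝓑 (z 0) + (τ / 2) • obs 𝓑 g := by
    rw [em]
    simp only [obs, Prod.snd_add, Prod.smul_snd, map_add, map_smul]
  have hGa : ‖G‖ ≤ ‖a‖ + b * ‖Z‖ := by
    have e : ‖G‖ ^ 2 = inner ℝ a G - inner ℝ (obs 𝓑 (z 0)) (obs 𝓑 g)
        - τ / 2 * ‖obs 𝓑 g‖ ^ 2 := by
      rw [← real_inner_self_eq_norm_sq]
      conv_lhs => enter [2]; rw [hJg]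
      rw [inner_sub_left, inner_add_left, real_inner_smul_left, inner_waveOp_self h hgd,
        inner_toEnergy_ctrl, hobs, inner_add_left, real_inner_smul_left, real_inner_self_eq_norm_sq]
      ring
    have b1 := real_inner_le_norm a G
    have b2 : -inner ℝ (obs 𝓑 (z 0)) (obs 𝓑 g) ≤ b * ‖Z‖ * ‖G‖ := by
      have := (abs_le.1 (abs_real_inner_le_norm (obs 𝓑 (z 0)) (obs 𝓑 g))).1
      have h2 : ‖obs 𝓑 (z 0)‖ * ‖obs 𝓑 g‖ ≤ (‖𝓑‖ * ‖Z‖) * (‖𝓑‖ * ‖G‖) := by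
        gcongr <;> exact norm_obs_le _ _
      rw [hb]
      linarith
    have b3 : 0 ≤ τ / 2 * ‖obs 𝓑 g‖ ^ 2 := by positivity
    rcases (norm_nonneg G).eq_or_lt with h0 | h0
    · rw [← h0]
      positivity
    · refine le_of_mul_le_mul_right ?_ h0
      nlinarith
  have hAzt : ‖toEnergy 𝒜 (waveOp 𝒜 (zt 1))‖ ≤ 2 * ‖G‖ + ‖a‖ + 2 * b * (‖Z‖ + ‖G‖) := by
    -- `A (zt 1) = a + τ A g`, and the equation for `G` removes `τ A g`, so no bound on `A g` is
    -- needed.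
    have e : toEnergy 𝒜 (waveOp 𝒜 (zt 1))
        = (2 : ℝ) • G + (2 : ℝ) • toEnergy 𝒜 (ctrl 𝓑 (obs 𝓑 m)) - a := by
      have e1 : toEnergy 𝒜 (waveOp 𝒜 (zt 1)) = a + τ • toEnergy 𝒜 (waveOp 𝒜 g) := by
        rw [ezt, waveOp_add h0 (Submodule.smul_mem _ _ hgd), waveOp_smul _ hgd,
          toEnergy_add (waveOp_mem h0) (Submodule.smul_mem _ _ (waveOp_mem hgd)),
          toEnergy_smul _ (waveOp_mem hgd)]
      rw [e1, hJg]
      module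
    have hM : ‖toEnergy 𝒜 m‖ ≤ ‖Z‖ + ‖G‖ := by
      rw [em, toEnergy_add (H.mem 0) (Submodule.smul_mem _ _ hge), toEnergy_smul _ hge]
      refine (norm_add_le _ _).trans ?_
      rw [norm_smul, Real.norm_of_nonneg (by positivity)]
      nlinarith [norm_nonneg G]
    have hc : ‖toEnergy 𝒜 (ctrl 𝓑 (obs 𝓑 m))‖ ≤ b * (‖Z‖ + ‖G‖) :=
      (norm_ctrl_obs_le m).trans (by gcongr)
    rw [e]
    refine (norm_sub_le _ _).trans ?_
    have := norm_add_le ((2 : ℝ) • G) ((2 : ℝ) • toEnergy 𝒜 (ctrl 𝓑 (obs 𝓑 m)))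
    rw [norm_smul, norm_smul, Real.norm_of_nonneg (by norm_num : (0 : ℝ) ≤ 2)] at this
    linarith
  have hfin : ‖toEnergy 𝒜 (z 1 - z 0)‖ ≤ τ * (‖G‖ + ‖toEnergy 𝒜 (waveOp 𝒜 (zt 1))‖) := by
    have h1 := (H.viscosity_step 0).norm_sub_le h hτ hτ1 hztd
    have e : toEnergy 𝒜 (zt 1) = Z + τ • G := by
      rw [ezt, toEnergy_add (H.mem 0) (Submodule.smul_mem _ _ hge), toEnergy_smul _ hge]
    rw [toEnergy_sub (H.mem 1) (H.mem 0)]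
    have e2 : toEnergy 𝒜 (z 1) - toEnergy 𝒜 (z 0)
        = (toEnergy 𝒜 (z 1) - toEnergy 𝒜 (zt 1)) + τ • G := by
      rw [e]
      abel
    rw [e2]
    refine (norm_add_le _ _).trans ?_
    rw [norm_smul, Real.norm_of_nonneg hτ.le]
    simp only [zero_add] at h1
    linarith
  have hZ : ‖Z‖ ≤ (1 + ‖inverse h‖) * ‖a‖ := by
    have := energyNormSq_le_waveOp h h0
    rw [← norm_toEnergy_sq, ← norm_toEnergy_sq] at this
    refine (sq_le_sq₀ (norm_nonneg _) (by positivity)).1 (this.trans ?_)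
    rw [mul_pow]
    gcongr
    nlinarith [norm_nonneg (inverse h), sq_nonneg ‖inverse h‖]
  have hbZ : b * ‖Z‖ ≤ b * (1 + ‖inverse h‖) * ‖a‖ := by
    rw [mul_assoc]
    gcongr
  have hGb : ‖G‖ ≤ (1 + b * (1 + ‖inverse h‖)) * ‖a‖ := by linarith
  have hbG : b * ‖G‖ ≤ b * ((1 + b * (1 + ‖inverse h‖)) * ‖a‖) := by gcongr
  -- With `c = 1 + b (1 + ‖R‖)`, `R` the bounded inverse, the bounds add up to `3c + 1 + 2(c - 1) +
  -- 2bc ≤ (5 + 2b) c`.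
  have htot : ‖toEnergy 𝒜 (z 1 - z 0)‖
      ≤ τ * (((5 + 2 * b) * (1 + b * (1 + ‖inverse h‖))) * ‖a‖) := by
    refine hfin.trans ?_
    gcongr
    linarith [norm_nonneg a]
  rw [waveDomainNormSq_eq, ← norm_toEnergy_sq, ← norm_toEnergy_sq, ← ha]
  calc ‖toEnergy 𝒜 (z 1 - z 0)‖ ^ 2
      ≤ (τ * (((5 + 2 * b) * (1 + b * (1 + ‖inverse h‖))) * ‖a‖)) ^ 2 := by gcongr
    _ = _ := by ring

/-! ### The estimate on the modes of low frequency -/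

-- Pair the first equation with `v` and the second with `-p`: the viscous cross terms `τ² s² ⟨p, v⟩`
-- cancel, while the skew part adds up to `s (1 + κ)(‖p‖² + ‖v‖²)`. The condition `τ s ≤ 1` absorbs
-- the midpoint corrections in `d` and `e`.
omit h in
theorem modal_estimate {p v d e f g : X} {s κ τ : ℝ} (hs : 0 ≤ s) (hκ : 0 ≤ κ) (hτ : 0 ≤ τ)
    (hsτ : τ * s ≤ 1)
    (h1 : s • ((1 + κ) • v - (τ / 2) • e) - (τ ^ 2 * s ^ 2) • p = d + f)
    (h2 : -(s • ((1 + κ) • p - (τ / 2) • d)) - (τ ^ 2 * s ^ 2) • v = e + g) :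
    s ^ 2 * (‖p‖ ^ 2 + ‖v‖ ^ 2) ≤ 4 * (‖d‖ ^ 2 + ‖e‖ ^ 2 + (‖f‖ ^ 2 + ‖g‖ ^ 2)) := by
  have bound : ∀ x y w : X, ‖x + y + (s * τ / 2) • w‖ ≤ ‖x‖ + ‖y‖ + 1 / 2 * ‖w‖ := fun x y w => by
    refine (norm_add₃_le).trans ?_
    rw [norm_smul, Real.norm_of_nonneg (by positivity)]
    gcongr
    linarith
  set G₁ := d + f + (s * τ / 2) • e with hG₁
  set G₂ := -e + -g + (s * τ / 2) • d with hG₂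
  have b₁ : ‖G₁‖ ≤ ‖d‖ + ‖f‖ + 1 / 2 * ‖e‖ := bound d f e
  have b₂ : ‖G₂‖ ≤ ‖e‖ + ‖g‖ + 1 / 2 * ‖d‖ := by simpa using bound (-e) (-g) d
  have e₁ : s * (1 + κ) * ‖v‖ ^ 2 - τ ^ 2 * s ^ 2 * inner ℝ p v = inner ℝ G₁ v := by
    rw [hG₁, ← h1, ← real_inner_self_eq_norm_sq]
    simp only [inner_sub_left, inner_add_left, real_inner_smul_left]
    ring
  have e₂ : s * (1 + κ) * ‖p‖ ^ 2 + τ ^ 2 * s ^ 2 * inner ℝ p v = inner ℝ G₂ p := by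
    rw [hG₂, ← neg_add, ← h2, ← real_inner_self_eq_norm_sq]
    simp only [inner_sub_left, inner_add_left, inner_neg_left, real_inner_smul_left,
      real_inner_comm p v]
    ring
  have c₁ := real_inner_le_norm G₁ v
  have c₂ := real_inner_le_norm G₂ p
  have hW : s * (‖p‖ ^ 2 + ‖v‖ ^ 2) ≤ ‖G₁‖ * ‖v‖ + ‖G₂‖ * ‖p‖ := by
    have : 0 ≤ s * κ * (‖p‖ ^ 2 + ‖v‖ ^ 2) := by positivity
    linarith
  have hW2 : s ^ 2 * (‖p‖ ^ 2 + ‖v‖ ^ 2) ≤ ‖G₁‖ ^ 2 + ‖G₂‖ ^ 2 := by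
    have := mul_le_mul_of_nonneg_left hW hs
    nlinarith [sq_nonneg (‖G₁‖ - s * ‖v‖), sq_nonneg (‖G₂‖ - s * ‖p‖)]
  have q₁ : ‖G₁‖ ^ 2 ≤ 3 * (‖d‖ ^ 2 + ‖f‖ ^ 2 + 1 / 4 * ‖e‖ ^ 2) := by
    refine (pow_le_pow_left₀ (norm_nonneg _) b₁ 2).trans ?_
    nlinarith [sq_nonneg (‖d‖ - ‖f‖), sq_nonneg (‖d‖ - 1 / 2 * ‖e‖), sq_nonneg (‖f‖ - 1 / 2 * ‖e‖)]
  have q₂ : ‖G₂‖ ^ 2 ≤ 3 * (‖e‖ ^ 2 + ‖g‖ ^ 2 + 1 / 4 * ‖d‖ ^ 2) := by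
    refine (pow_le_pow_left₀ (norm_nonneg _) b₂ 2).trans ?_
    nlinarith [sq_nonneg (‖e‖ - ‖g‖), sq_nonneg (‖e‖ - 1 / 2 * ‖d‖), sq_nonneg (‖g‖ - 1 / 2 * ‖d‖)]
  nlinarith [sq_nonneg ‖d‖, sq_nonneg ‖e‖, sq_nonneg ‖f‖, sq_nonneg ‖g‖]

/-- For frequencies below `1 / τ`, the norm in `D(A)` of the state after a step is controlled by the
increment and the forcing. -/
theorem IsForcedStep.modeEnergy_le {τ : ℝ} (hτ : 0 < τ) {f z zt z' : X × X}
    (H : IsForcedStep 𝒜 τ f z zt z') {η : ℝ} (hη : 0 < η) (hητ : τ ^ 2 * η ≤ 1) :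
    η * modeEnergy 𝒜 η z' ≤
      4 * (modeEnergy 𝒜 η (τ⁻¹ • (z' - z)) + modeEnergy 𝒜 η f) := by
  have hs2 : √η ^ 2 = η := Real.sq_sqrt hη.le
  set D := τ⁻¹ • (z' - z) with hD
  have ez : z = z' - τ • D := by
    rw [hD, smul_inv_smul₀ hτ.ne']
    abel
  have em : mid z zt = z' - (τ ^ 3 / 2) • waveOp 𝒜 (waveOp 𝒜 z') - (τ / 2) • D := by
    rw [mid, H.viscosity_step.eq_sub hτ, ez]
    module
  have eD : D = waveOp 𝒜 (mid z zt) - f + τ ^ 2 • waveOp 𝒜 (waveOp 𝒜 z') := by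
    rw [← H.midpoint_step, ← H.viscosity_step.eq, ← smul_add, hD]
    congr 1
    abel
  have hz1 := (mem_waveDomain.1 H.viscosity_step.mem).1
  have hz2 : z'.2 ∈ 𝒜.domain := (mem_waveDomain.1 H.viscosity_step.mem_sq).1
  have hm1 := (mem_waveDomain.1 H.mid_mem).1
  have em1 : eigenProj 𝒜 η (mid z zt).1 = (1 + τ ^ 3 * η / 2) • eigenProj 𝒜 η z'.1
      - (τ / 2) • eigenProj 𝒜 η D.1 := by
    rw [em]
    simp only [waveOp, Prod.fst_sub, Prod.smul_fst, map_sub, map_smul, map_neg, eigenProj_app h hz1]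
    module
  have em2 : eigenProj 𝒜 η (mid z zt).2 = (1 + τ ^ 3 * η / 2) • eigenProj 𝒜 η z'.2
      - (τ / 2) • eigenProj 𝒜 η D.2 := by
    rw [em]
    simp only [waveOp, Prod.snd_sub, Prod.smul_snd, map_sub, map_smul, map_neg, eigenProj_app h hz2]
    module
  have eD1 : eigenProj 𝒜 η D.1 + eigenProj 𝒜 η f.1
      = eigenProj 𝒜 η (mid z zt).2 - (τ ^ 2 * η) • eigenProj 𝒜 η z'.1 := by
    conv_lhs => rw [eD]
    simp only [waveOp, Prod.fst_sub, Prod.fst_add, Prod.smul_fst, map_sub, map_add, map_smul,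
      map_neg, eigenProj_app h hz1]
    module
  have eD2 : eigenProj 𝒜 η D.2 + eigenProj 𝒜 η f.2
      = -(η • eigenProj 𝒜 η (mid z zt).1) - (τ ^ 2 * η) • eigenProj 𝒜 η z'.2 := by
    conv_lhs => rw [eD]
    simp only [waveOp, Prod.snd_sub, Prod.snd_add, Prod.smul_snd, map_sub, map_add, map_smul,
      map_neg, eigenProj_app h hz2, eigenProj_app h hm1]
    module
  have key := modal_estimate (p := √η • eigenProj 𝒜 η z'.1) (v := eigenProj 𝒜 η z'.2)
    (d := √η • eigenProj 𝒜 η D.1) (e := eigenProj 𝒜 η D.2) (f := √η • eigenProj 𝒜 η f.1)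
    (g := eigenProj 𝒜 η f.2) (s := √η) (κ := τ ^ 3 * η / 2) (τ := τ) (Real.sqrt_nonneg _)
    (by positivity) hτ.le ?_ ?_ ?_
  · simp only [norm_smul, mul_pow, Real.norm_eq_abs, sq_abs, hs2] at key
    exact key
  · refine (sq_le_sq₀ (by positivity) zero_le_one).1 ?_
    rw [mul_pow, hs2, one_pow]
    exact hητ
  · rw [← smul_add, eD1, ← em2, hs2]
    module
  · rw [eD2, em1, hs2, smul_comm (1 + τ ^ 3 * η / 2), smul_comm (τ / 2), ← smul_sub, smul_smul √η,
      ← pow_two, hs2]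

end

noncomputable section

variable {X Y : Type*} [NormedAddCommGroup X] [InnerProductSpace ℝ X] [CompleteSpace X]
  [NormedAddCommGroup Y] [InnerProductSpace ℝ Y] [CompleteSpace Y]
  {𝒜 : X →ₗ.[ℝ] X} {𝓑 : Y →L[ℝ] X}

/-! ### Comparison of the damped and the conservative scheme -/

theorem norm_sub_sq_le_two_mul {E : Type*} [SeminormedAddCommGroup E] (a b : E) :
    ‖a - b‖ ^ 2 ≤ 2 * ‖a‖ ^ 2 + 2 * ‖b‖ ^ 2 := by
  have := pow_le_pow_left₀ (norm_nonneg _) (norm_sub_le a b) 2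
  nlinarith [sq_nonneg (‖a‖ - ‖b‖)]

theorem energyNormSq_sub_le_two_mul {z z' : X × X} (hz : z ∈ energySpace 𝒜)
    (hz' : z' ∈ energySpace 𝒜) :
    energyNormSq 𝒜 (z - z') ≤ 2 * energyNormSq 𝒜 z + 2 * energyNormSq 𝒜 z' := by
  simp only [← norm_toEnergy_sq, toEnergy_sub hz hz']
  exact norm_sub_sq_le_two_mul _ _

variable (h : IsPositiveCompactInverse 𝒜)

include h

/-- The energy estimate for the forced scheme with zero initial state. -/
theorem forced_energy_le {τ : ℝ} (hτ : 0 < τ) {f w wt : ℕ → X × X} {r : ℕ → ℝ}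
    (H : ∀ k, IsForcedStep 𝒜 τ (f k) (w k) (wt (k + 1)) (w (k + 1))) (hw : w 0 = 0)
    (hr : ∀ k, ‖toEnergy 𝒜 (f k)‖ ≤ r k) (n : ℕ) :
    energyNormSq 𝒜 (w n) + ∑ k ∈ Finset.range n, (2 * τ ^ 3 * energyNormSq 𝒜 (waveOp 𝒜 (w (k + 1)))
      + τ ^ 6 * energyNormSq 𝒜 (waveOp 𝒜 (waveOp 𝒜 (w (k + 1))))) ≤
    (∑ k ∈ Finset.range n, τ * r k) ^ 2 := by
  have hr0 : ∀ k, 0 ≤ r k := fun k => (norm_nonneg _).trans (hr k)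
  induction n with
  | zero => simp [hw, energyNormSq, powApp]
  | succ n ih =>
    rw [Finset.sum_range_succ, Finset.sum_range_succ]
    set P := ∑ k ∈ Finset.range n, τ * r k
    set S := ∑ k ∈ Finset.range n, (2 * τ ^ 3 * energyNormSq 𝒜 (waveOp 𝒜 (w (k + 1)))
      + τ ^ 6 * energyNormSq 𝒜 (waveOp 𝒜 (waveOp 𝒜 (w (k + 1)))))
    have hP : 0 ≤ P := Finset.sum_nonneg fun k _ => mul_nonneg hτ.le (hr0 k)
    have hS : 0 ≤ S := Finset.sum_nonneg fun k _ => by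
      have h1 := energyNormSq_nonneg (𝒜 := 𝒜) (waveOp 𝒜 (w (k + 1)))
      have h2 := energyNormSq_nonneg (𝒜 := 𝒜) (waveOp 𝒜 (waveOp 𝒜 (w (k + 1))))
      positivity
    have e := (H n).energy_eq h hτ
    have b1 := (H n).norm_mid_le h hτ
    have b2 := (abs_le.1 (abs_real_inner_le_norm (toEnergy 𝒜 (f n))
      (toEnergy 𝒜 (mid (w n) (wt (n + 1)))))).1
    have hw_le : ‖toEnergy 𝒜 (w n)‖ ≤ P := by
      refine (sq_le_sq₀ (norm_nonneg _) hP).1 ?_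
      rw [norm_toEnergy_sq]
      linarith
    have b3 : ‖toEnergy 𝒜 (f n)‖ * ‖toEnergy 𝒜 (mid (w n) (wt (n + 1)))‖
        ≤ r n * (P + τ / 2 * r n) := by
      refine mul_le_mul (hr n) (b1.trans ?_) (norm_nonneg _) (hr0 n)
      gcongr
      exact hr n
    -- The bound closes exactly: `P² + 2τ r (P + τ r / 2) = (P + τ r)²`.
    nlinarith [mul_le_mul_of_nonneg_left b3 hτ.le, mul_le_mul_of_nonneg_left b2 hτ.le]

/-- The observability inequality for the conservative scheme controls the dissipation of the damped
scheme over a window of length `T`. -/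
theorem IsDampedSolution.pairNormSq_le {T c β τ : ℝ} (hT : 0 < T) (hc : 0 < c) (hτ : 0 < τ)
    (hτ1 : τ < 1)
    (hobs : ∀ u ut : ℕ → X × X, IsConservativeSolution 𝒜 τ u ut → u 0 ∈ waveDomain 𝒜 →
      WeakObservability 𝒜 𝓑 T c β τ u ut)
    {z zt : ℕ → X × X} (H : IsDampedSolution 𝒜 𝓑 τ z zt) (hz : z 0 ∈ waveDomain 𝒜) :
    pairNormSq 𝒜 (-β) (-β - 1 / 2) (z 0) ≤
      (2 + 2 * (T + 1) * ‖𝓑‖ ^ 2 + 2 * (T + 1) ^ 2 * ‖𝓑‖ ^ 4) / c *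
        (energyNormSq 𝒜 (z 0) - energyNormSq 𝒜 (z (⌊T / τ⌋₊ + 1))) := by
  obtain ⟨u, ut, hu, hu0⟩ := exists_conservativeSolution h hτ (H.mem 0)
  have hobs' := hobs u ut hu (hu0 ▸ hz)
  unfold WeakObservability at hobs'
  rw [hu0] at hobs'
  set N := ⌊T / τ⌋₊ + 1 with hN
  have hNτ : N * τ ≤ T + 1 := by
    have := Nat.floor_le (div_nonneg hT.le hτ.le)
    rw [le_div_iff₀ hτ] at this
    rw [hN]
    push_cast
    linarith
  set b := ‖𝓑‖ with hb
  have hb0 : 0 ≤ b := norm_nonneg _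
  set m := fun k => mid (z k) (zt (k + 1)) with hm
  set w := fun k => z k - u k with hw
  set wt := fun k => zt k - ut k with hwt
  -- The difference of the two schemes starts from zero and is driven by the damping term alone.
  have Hw : ∀ k, IsForcedStep 𝒜 τ (ctrl 𝓑 (obs 𝓑 (m k))) (w k) (wt (k + 1)) (w (k + 1)) :=
    fun k => by simpa only [sub_zero] using (H.step k).sub (hu.step k)
  have hw0 : w 0 = 0 := by simp [hw, hu0]
  have hr : ∀ k, ‖toEnergy 𝒜 (ctrl 𝓑 (obs 𝓑 (m k)))‖ ≤ b * ‖obs 𝓑 (m k)‖ :=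
    fun k => norm_toEnergy_ctrl_le _ _
  have hen := forced_energy_le h hτ Hw hw0 hr
  set P : ℕ → ℝ := fun n => ∑ k ∈ Finset.range n, τ * (b * ‖obs 𝓑 (m k)‖) with hP
  set S := τ * ∑ k ∈ Finset.range N, ‖obs 𝓑 (m k)‖ ^ 2 with hS
  have hS0 : 0 ≤ S := by positivity
  have hP0 : ∀ n, 0 ≤ P n := fun n => Finset.sum_nonneg fun k _ => by positivity
  have hPmono : Monotone P := monotone_nat_of_le_succ fun n => by
    simp only [hP, Finset.sum_range_succ]
    have : 0 ≤ τ * (b * ‖obs 𝓑 (m n)‖) := by positivity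
    linarith
  have hPS : P N ^ 2 ≤ (T + 1) * b ^ 2 * S := by
    have e : P N = τ * b * ∑ k ∈ Finset.range N, ‖obs 𝓑 (m k)‖ := by
      rw [hP, Finset.mul_sum]
      exact Finset.sum_congr rfl fun k _ => by ring
    have cs := sq_sum_le_card_mul_sum_sq (s := Finset.range N) (f := fun k => ‖obs 𝓑 (m k)‖)
    rw [Finset.card_range] at cs
    calc P N ^ 2 = (τ * b) ^ 2 * (∑ k ∈ Finset.range N, ‖obs 𝓑 (m k)‖) ^ 2 := by rw [e, mul_pow]
      _ ≤ (τ * b) ^ 2 * (N * ∑ k ∈ Finset.range N, ‖obs 𝓑 (m k)‖ ^ 2) := by gcongr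
      _ = (N * τ) * b ^ 2 * S := by
          rw [hS]
          ring
      _ ≤ (T + 1) * b ^ 2 * S := by gcongr
  have hmidw : ∀ k ∈ Finset.range N, ‖obs 𝓑 (mid (w k) (wt (k + 1)))‖ ^ 2 ≤ b ^ 2 * P N ^ 2 := by
    intro k hk
    have h1 : ‖toEnergy 𝒜 (w k)‖ ≤ P k := by
      refine (sq_le_sq₀ (norm_nonneg _) (hP0 k)).1 ?_
      rw [norm_toEnergy_sq]
      refine le_trans (le_add_of_nonneg_right (Finset.sum_nonneg fun i _ => ?_)) (hen k)
      have h1 := energyNormSq_nonneg (𝒜 := 𝒜) (waveOp 𝒜 (w (i + 1)))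
      have h2 := energyNormSq_nonneg (𝒜 := 𝒜) (waveOp 𝒜 (waveOp 𝒜 (w (i + 1))))
      positivity
    have h2 : ‖toEnergy 𝒜 (mid (w k) (wt (k + 1)))‖ ≤ P N := by
      have h3 := (Hw k).norm_mid_le h hτ
      have h4 : P (k + 1) = P k + τ * (b * ‖obs 𝓑 (m k)‖) := Finset.sum_range_succ _ _
      have h5 := hPmono (Nat.succ_le_of_lt (Finset.mem_range.1 hk))
      have h6 := mul_le_mul_of_nonneg_left (hr k) hτ.le
      have h7 : 0 ≤ τ * (b * ‖obs 𝓑 (m k)‖) := by positivity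
      simp only [Nat.succ_eq_add_one] at h5
      linarith
    calc ‖obs 𝓑 (mid (w k) (wt (k + 1)))‖ ^ 2
        ≤ (b * ‖toEnergy 𝒜 (mid (w k) (wt (k + 1)))‖) ^ 2 := by
          gcongr
          exact norm_obs_le _ _
      _ ≤ (b * P N) ^ 2 := by gcongr
      _ = _ := by ring
  have hu_eq : ∀ k, u k = z k - w k := fun k => by simp [hw]
  have hmid_eq : ∀ k, mid (u k) (ut (k + 1)) = m k - mid (w k) (wt (k + 1)) := fun k => by
    rw [hm, ← mid_sub]
    simp [hw, hwt]
  have t1 : τ * ∑ k ∈ Finset.range N, ‖obs 𝓑 (mid (u k) (ut (k + 1)))‖ ^ 2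
      ≤ 2 * S + 2 * ((T + 1) * b ^ 2 * P N ^ 2) := by
    have : ∑ k ∈ Finset.range N, ‖obs 𝓑 (mid (u k) (ut (k + 1)))‖ ^ 2
        ≤ ∑ k ∈ Finset.range N, (2 * ‖obs 𝓑 (m k)‖ ^ 2 + 2 * (b ^ 2 * P N ^ 2)) := by
      refine Finset.sum_le_sum fun k hk => ?_
      rw [hmid_eq, obs_sub]
      refine (norm_sub_sq_le_two_mul _ _).trans ?_
      linarith [hmidw k hk]
    rw [Finset.sum_add_distrib, ← Finset.mul_sum, Finset.sum_const, Finset.card_range,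
      nsmul_eq_mul] at this
    have h2 := mul_le_mul_of_nonneg_left this hτ.le
    have h3 : N * τ * (b ^ 2 * P N ^ 2) ≤ (T + 1) * (b ^ 2 * P N ^ 2) := by gcongr
    linarith
  have t2 : τ * ∑ k ∈ Finset.range N, τ ^ 2 * energyNormSq 𝒜 (waveOp 𝒜 (u (k + 1)))
      + τ * ∑ k ∈ Finset.range N, τ ^ 5 * energyNormSq 𝒜 (waveOp 𝒜 (waveOp 𝒜 (u (k + 1))))
      ≤ 2 * ∑ k ∈ Finset.range N, (2 * τ ^ 3 * energyNormSq 𝒜 (waveOp 𝒜 (z (k + 1)))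
        + τ ^ 6 * energyNormSq 𝒜 (waveOp 𝒜 (waveOp 𝒜 (z (k + 1))))) + 2 * P N ^ 2 := by
    have h1 := (le_add_of_nonneg_left (energyNormSq_nonneg (𝒜 := 𝒜) (w N))).trans (hen N)
    have h2 : τ * ∑ k ∈ Finset.range N, τ ^ 2 * energyNormSq 𝒜 (waveOp 𝒜 (u (k + 1)))
        + τ * ∑ k ∈ Finset.range N, τ ^ 5 * energyNormSq 𝒜 (waveOp 𝒜 (waveOp 𝒜 (u (k + 1))))
        ≤ ∑ k ∈ Finset.range N, (2 * (2 * τ ^ 3 * energyNormSq 𝒜 (waveOp 𝒜 (z (k + 1)))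
          + τ ^ 6 * energyNormSq 𝒜 (waveOp 𝒜 (waveOp 𝒜 (z (k + 1)))))
          + 2 * (2 * τ ^ 3 * energyNormSq 𝒜 (waveOp 𝒜 (w (k + 1)))
          + τ ^ 6 * energyNormSq 𝒜 (waveOp 𝒜 (waveOp 𝒜 (w (k + 1)))))) := by
      rw [Finset.mul_sum, Finset.mul_sum, ← Finset.sum_add_distrib]
      refine Finset.sum_le_sum fun k _ => ?_
      have vz := H.viscosity_step k
      have vw := (Hw k).viscosity_step
      rw [hu_eq, waveOp_sub vz.mem vw.mem, waveOp_sub vz.mem_sq vw.mem_sq]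
      have a1 := energyNormSq_sub_le_two_mul (waveOp_mem vz.mem) (waveOp_mem vw.mem)
      have a2 := energyNormSq_sub_le_two_mul (waveOp_mem vz.mem_sq) (waveOp_mem vw.mem_sq)
      have a3 := mul_le_mul_of_nonneg_left a1 (pow_pos hτ 3).le
      have a4 := mul_le_mul_of_nonneg_left a2 (pow_pos hτ 6).le
      have a5 := mul_nonneg (pow_pos hτ 3).le (energyNormSq_nonneg (𝒜 := 𝒜) (waveOp 𝒜 (z (k + 1))))
      have a6 := mul_nonneg (pow_pos hτ 3).le (energyNormSq_nonneg (𝒜 := 𝒜) (waveOp 𝒜 (w (k + 1))))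
      linarith
    refine h2.trans ?_
    rw [Finset.sum_add_distrib, ← Finset.mul_sum, ← Finset.mul_sum]
    exact add_le_add le_rfl (mul_le_mul_of_nonneg_left h1 zero_le_two)
  have tel : 2 * S + ∑ k ∈ Finset.range N, (2 * τ ^ 3 * energyNormSq 𝒜 (waveOp 𝒜 (z (k + 1)))
        + τ ^ 6 * energyNormSq 𝒜 (waveOp 𝒜 (waveOp 𝒜 (z (k + 1)))))
      = energyNormSq 𝒜 (z 0) - energyNormSq 𝒜 (z N) := by
    rw [← Finset.sum_range_sub' (fun k => energyNormSq 𝒜 (z k)), hS, ← mul_assoc, Finset.mul_sum,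
      ← Finset.sum_add_distrib]
    refine Finset.sum_congr rfl fun k _ => ?_
    rw [H.energy_eq h hτ k]
    ring
  set Δ := energyNormSq 𝒜 (z 0) - energyNormSq 𝒜 (z N)
  have hV : 0 ≤ ∑ k ∈ Finset.range N, (2 * τ ^ 3 * energyNormSq 𝒜 (waveOp 𝒜 (z (k + 1)))
        + τ ^ 6 * energyNormSq 𝒜 (waveOp 𝒜 (waveOp 𝒜 (z (k + 1))))) :=
    Finset.sum_nonneg fun k _ => by
      have h1 := energyNormSq_nonneg (𝒜 := 𝒜) (waveOp 𝒜 (z (k + 1)))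
      have h2 := energyNormSq_nonneg (𝒜 := 𝒜) (waveOp 𝒜 (waveOp 𝒜 (z (k + 1))))
      positivity
  -- The observation and viscosity of `z` cost at most `2Δ`; the terms in `P N` give the summands in
  -- `‖𝓑‖ ^ 2` and `‖𝓑‖ ^ 4`.
  have hSΔ : S ≤ Δ := by linarith
  have f1 : P N ^ 2 ≤ (T + 1) * b ^ 2 * Δ := hPS.trans (by gcongr)
  have f2 : (T + 1) * b ^ 2 * P N ^ 2 ≤ (T + 1) * b ^ 2 * ((T + 1) * b ^ 2 * Δ) := by gcongr
  rw [div_mul_eq_mul_div, le_div_iff₀ hc]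
  linarith

end

noncomputable section

/-! ### Decay of a sequence satisfying a difference inequality -/

/-- Discrete form of `y ^ (1 + α) ≤ -C y'`. If the bound `v` at `m + 1` failed, then `y m > v (1 + v
^ α / C)`; the condition on `M` makes the last factor at least `((m + 2)/(m + 1)) ^ (1/α)`,
contradicting the bound at `m`. -/
theorem le_div_rpow_of_mul_rpow_le {α C M : ℝ} (hα : 0 < α) (hC : 0 < C) (hM : 0 < M)
    (hMα : 2 * C * Real.exp α⁻¹ * α⁻¹ ≤ M ^ α) {y : ℕ → ℝ} (h0 : y 0 ≤ M)
    (hy : ∀ m, 0 < y (m + 1) → y (m + 1) * y (m + 1) ^ α ≤ C * (y m - y (m + 1))) (m : ℕ) :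
    y m ≤ M / ((m : ℝ) + 1) ^ α⁻¹ := by
  induction m with
  | zero => simpa using h0
  | succ m ih =>
    by_contra! hlt
    push_cast at hlt
    set v := M / ((m : ℝ) + 1 + 1) ^ α⁻¹ with hv
    have hv0 : 0 < v := by positivity
    have hyp : 0 < y (m + 1) := hv0.trans hlt
    have hvα : v ^ α = M ^ α / ((m : ℝ) + 1 + 1) := by
      rw [hv, Real.div_rpow hM.le (by positivity), ← Real.rpow_mul (by positivity),
        inv_mul_cancel₀ hα.ne', Real.rpow_one]
    have hmul : v * v ^ α ≤ y (m + 1) * y (m + 1) ^ α := by gcongr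
    have hstep : v + v * v ^ α / C < y m := by
      have h1 := hmul.trans (hy m hyp)
      have h2 : v * v ^ α / C ≤ y m - y (m + 1) := by
        rw [div_le_iff₀ hC]
        linarith
      linarith
    set t := α⁻¹ * ((m : ℝ) + 1)⁻¹ with ht
    have ht0 : 0 < t := by positivity
    have htle : t ≤ α⁻¹ := by
      refine mul_le_of_le_one_right (by positivity) (inv_le_one_of_one_le₀ ?_)
      linarith [(Nat.cast_nonneg m : (0 : ℝ) ≤ m)]
    have hexp : Real.exp t ≤ 1 + v ^ α / C := by
      have e1 : Real.exp t ≤ 1 + t * Real.exp t := by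
        have := Real.add_one_le_exp (-t)
        have h2 : Real.exp (-t) * Real.exp t = 1 := by rw [← Real.exp_add]; simp
        nlinarith [Real.exp_pos t]
      have e2 : t * Real.exp t ≤ t * Real.exp α⁻¹ := by gcongr
      have e3 : t * Real.exp α⁻¹ ≤ v ^ α / C := by
        rw [hvα, le_div_iff₀ hC, le_div_iff₀ (by positivity)]
        have : t * ((m : ℝ) + 1 + 1) ≤ 2 * α⁻¹ := by
          rw [ht, mul_assoc, mul_comm 2]
          gcongr
          rw [inv_mul_le_iff₀ (by positivity)]
          linarith [(Nat.cast_nonneg m : (0 : ℝ) ≤ m)]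
        calc t * Real.exp α⁻¹ * C * ((m : ℝ) + 1 + 1)
            = (t * ((m : ℝ) + 1 + 1)) * (Real.exp α⁻¹ * C) := by ring
          _ ≤ (2 * α⁻¹) * (Real.exp α⁻¹ * C) := by gcongr
          _ = 2 * C * Real.exp α⁻¹ * α⁻¹ := by ring
          _ ≤ M ^ α := hMα
      linarith
    have hratio : (((m : ℝ) + 1 + 1) / ((m : ℝ) + 1)) ^ α⁻¹ ≤ Real.exp t := by
      have h1 : ((m : ℝ) + 1 + 1) / ((m : ℝ) + 1) ≤ Real.exp ((m : ℝ) + 1)⁻¹ := by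
        have := Real.add_one_le_exp ((m : ℝ) + 1)⁻¹
        have e : ((m : ℝ) + 1 + 1) / ((m : ℝ) + 1) = ((m : ℝ) + 1)⁻¹ + 1 := by
          field_simp
          ring
        rwa [e]
      calc (((m : ℝ) + 1 + 1) / ((m : ℝ) + 1)) ^ α⁻¹ ≤ (Real.exp ((m : ℝ) + 1)⁻¹) ^ α⁻¹ := by
            gcongr
        _ = Real.exp t := by rw [← Real.exp_mul, ht, mul_comm]
    have hend : M / ((m : ℝ) + 1) ^ α⁻¹ = v * (((m : ℝ) + 1 + 1) / ((m : ℝ) + 1)) ^ α⁻¹ := by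
      rw [hv, Real.div_rpow (by positivity) (by positivity)]
      field_simp
    have : M / ((m : ℝ) + 1) ^ α⁻¹ ≤ v * (1 + v ^ α / C) := by
      rw [hend]
      gcongr
      exact hratio.trans hexp
    have e : v * (1 + v ^ α / C) = v + v * v ^ α / C := by ring
    linarith

/-- Optimise in `R` after normalising `y = x / D`, then apply the preceding lemma. In `M`, the
summand `c` covers `m = 0` and the other one meets the size condition. -/
theorem exists_decay_constant {α a c : ℝ} (hα : 0 < α) (ha : 0 < a) (hc : 0 < c) :
    ∃ M : ℝ, 0 < M ∧ ∀ D : ℝ, ∀ x : ℕ → ℝ, 0 ≤ D → (∀ m, 0 ≤ x m) → Antitone x → x 0 ≤ c * D →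
      (∀ m : ℕ, ∀ R : ℝ, 0 < R →
        x (m + 1) ≤ a * (R ^ α + 1) * (x m - x (m + 1)) + a * D / R) →
      ∀ m : ℕ, x m ≤ M / ((m : ℝ) + 1) ^ α⁻¹ * D := by
  set C := 2 * a * ((2 * a) ^ α + c ^ α) with hC
  have hC0 : 0 < C := by positivity
  set Q := 2 * C * Real.exp α⁻¹ * α⁻¹ with hQ
  have hQ0 : 0 < Q := by positivity
  refine ⟨c + Q ^ α⁻¹, by positivity, fun D x hD hx hanti h0 hstep m => ?_⟩
  rcases hD.eq_or_lt with rfl | hD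
  · rw [mul_zero] at h0 ⊢
    exact (hanti (Nat.zero_le m)).trans h0
  have key := le_div_rpow_of_mul_rpow_le (α := α) (C := C) (M := c + Q ^ α⁻¹) hα hC0
    (by positivity) ?_ (y := fun m => x m / D) ?_ ?_ m
  · exact (div_le_iff₀ hD).1 key
  · calc Q = (Q ^ α⁻¹) ^ α := by
          rw [← Real.rpow_mul hQ0.le, inv_mul_cancel₀ hα.ne', Real.rpow_one]
      _ ≤ (c + Q ^ α⁻¹) ^ α := by
          gcongr
          linarith
  · have : x 0 / D ≤ c := (div_le_iff₀ hD).2 h0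
    exact this.trans (le_add_of_nonneg_right (by positivity))
  · intro m hm
    have hyc : x (m + 1) / D ≤ c := (div_le_iff₀ hD).2 ((hanti (Nat.zero_le _)).trans h0)
    -- With this `R` the remainder `a D / R` is half of `x (m + 1)` and is absorbed on the left.
    have hs := hstep m (2 * a / (x (m + 1) / D)) (div_pos (by positivity) hm)
    set y := x (m + 1) / D with hy
    have ex : x (m + 1) = y * D := by rw [hy, div_mul_cancel₀ _ hD.ne']
    have ex' : x m = x m / D * D := by rw [div_mul_cancel₀ _ hD.ne']
    set y₀ := x m / D with hy₀
    have hδ : 0 ≤ y₀ - y := by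
      rw [hy, hy₀, ← sub_div]
      exact div_nonneg (sub_nonneg.2 (hanti (Nat.le_succ m))) hD.le
    rw [ex, ex', show a * D / (2 * a / y) = y / 2 * D by field_simp, ← sub_mul, ← mul_assoc,
      ← add_mul] at hs
    have hs' := le_of_mul_le_mul_right hs hD
    have hya : 0 < y ^ α := by positivity
    rw [Real.div_rpow (by positivity) hm.le] at hs'
    have h1 : y * y ^ α ≤ 2 * a * ((2 * a) ^ α + y ^ α) * (y₀ - y) := by
      have h2 : y / 2 ≤ a * ((2 * a) ^ α / y ^ α + 1) * (y₀ - y) := by linarith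
      have h3 := mul_le_mul_of_nonneg_right h2 hya.le
      have h4 : a * ((2 * a) ^ α / y ^ α + 1) * (y₀ - y) * y ^ α
          = a * ((2 * a) ^ α + y ^ α) * (y₀ - y) := by field_simp
      linarith
    refine h1.trans ?_
    rw [hC]
    gcongr

end

noncomputable section

variable {X Y : Type*} [NormedAddCommGroup X] [InnerProductSpace ℝ X] [CompleteSpace X]
  [NormedAddCommGroup Y] [InnerProductSpace ℝ Y] [CompleteSpace Y]
  {𝒜 : X →ₗ.[ℝ] X} {𝓑 : Y →L[ℝ] X} (h : IsPositiveCompactInverse 𝒜)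

include h

/-! ### Decay of the damped scheme -/

/-- Interpolation: the frequencies below `R` are controlled by the weak norm, those above `1 / τ` by
the viscosity, and the remaining ones by the increment and the forcing. -/
theorem IsForcedStep.energyNormSq_le {β τ R : ℝ} (hβ : -(1 / 2) < β) (hτ : 0 < τ) (hR : 0 < R)
    {f z zt z' : X × X} (H : IsForcedStep 𝒜 τ f z zt z') :
    energyNormSq 𝒜 z' ≤ R ^ (1 + 2 * β) * pairNormSq 𝒜 (-β) (-β - 1 / 2) z'
      + R⁻¹ * (4 * (energyNormSq 𝒜 (τ⁻¹ • (z' - z)) + energyNormSq 𝒜 f))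
      + τ ^ 2 * energyNormSq 𝒜 (waveOp 𝒜 z') := by
  have hz' := H.viscosity_step.mem
  have hzE := waveDomain_le h hz'
  set d := τ⁻¹ • (z' - z) with hd
  have hdE : d ∈ energySpace 𝒜 := Submodule.smul_mem _ _ (Submodule.sub_mem _ hzE H.mem)
  set o : ℝ → ℝ := fun η => η ^ (2 * -β) * ‖eigenProj 𝒜 η z'.1‖ ^ 2
    + η ^ (2 * (-β - 1 / 2)) * ‖eigenProj 𝒜 η z'.2‖ ^ 2 with ho
  have ho0 : ∀ η, 0 ≤ o η := fun η => by
    simp only [ho, ← norm_rpow_smul_eigenProj_sq h]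
    positivity
  have hmode : ∀ η, modeEnergy 𝒜 η z' ≤ R ^ (1 + 2 * β) * o η
      + R⁻¹ * (4 * (modeEnergy 𝒜 η d + modeEnergy 𝒜 η f))
      + τ ^ 2 * modeEnergy 𝒜 η (waveOp 𝒜 z') := by
    intro η
    have n1 : 0 ≤ R ^ (1 + 2 * β) * o η := mul_nonneg (Real.rpow_nonneg hR.le _) (ho0 η)
    have n2 : 0 ≤ R⁻¹ * (4 * (modeEnergy 𝒜 η d + modeEnergy 𝒜 η f)) := by
      have := modeEnergy_nonneg h η d
      have := modeEnergy_nonneg h η f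
      positivity
    have n3 : 0 ≤ τ ^ 2 * modeEnergy 𝒜 η (waveOp 𝒜 z') :=
      mul_nonneg (sq_nonneg _) (modeEnergy_nonneg h _ _)
    have n4 := modeEnergy_nonneg h η z'
    rcases le_or_gt η 0 with hη | hη
    · rw [modeEnergy_of_nonpos h hη z']
      positivity
    rcases le_or_gt η R with hηR | hηR
    · have e : modeEnergy 𝒜 η z' = η ^ (1 + 2 * β) * o η := by
        rw [ho]
        simp only [modeEnergy]
        rw [mul_add, ← mul_assoc, ← mul_assoc, ← Real.rpow_add hη, ← Real.rpow_add hη,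
          show 1 + 2 * β + 2 * -β = 1 by ring, show 1 + 2 * β + 2 * (-β - 1 / 2) = 0 by ring,
          Real.rpow_one, Real.rpow_zero, one_mul]
      have : η ^ (1 + 2 * β) * o η ≤ R ^ (1 + 2 * β) * o η := by
        have := ho0 η
        gcongr
        linarith
      linarith
    rcases le_or_gt (τ ^ 2 * η) 1 with hητ | hητ
    · have := H.modeEnergy_le h hτ hη hητ
      have h2 : modeEnergy 𝒜 η z' ≤ R⁻¹ * (η * modeEnergy 𝒜 η z') := by
        rw [← mul_assoc]
        refine le_mul_of_one_le_left n4 ?_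
        rw [inv_mul_eq_div, one_le_div hR]
        exact hηR.le
      have h3 := mul_le_mul_of_nonneg_left this (inv_nonneg.2 hR.le)
      linarith
    · have : modeEnergy 𝒜 η z' ≤ τ ^ 2 * modeEnergy 𝒜 η (waveOp 𝒜 z') := by
        rw [modeEnergy_waveOp h hz', ← mul_assoc]
        exact le_mul_of_one_le_left n4 hητ.le
      linarith
  -- Only finite spectral sums have been bounded by the weak norm, so the comparison is made on
  -- finite sets of modes.
  refine hasSum_le_of_sum_le (hasSum_modeEnergy h hzE) fun F => ?_
  refine (Finset.sum_le_sum fun η _ => hmode η).trans ?_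
  rw [Finset.sum_add_distrib, Finset.sum_add_distrib, ← Finset.mul_sum, ← Finset.mul_sum,
    ← Finset.mul_sum, ← Finset.mul_sum]
  have s1 : ∑ η ∈ F, o η ≤ pairNormSq 𝒜 (-β) (-β - 1 / 2) z' := by
    rw [ho, Finset.sum_add_distrib, pairNormSq]
    -- If `-β ≥ 0` then `-β < 1/2`, so membership in `V` suffices; `-β - 1/2` is always negative.
    refine add_le_add (sum_rpow_mul_norm_eigenProj_sq_le h (fun hs => ?_) F)
      (sum_rpow_mul_norm_eigenProj_sq_le h (fun hs => ?_) F)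
    · exact mem_powDomain_of_le h hs (by linarith) (mem_energySpace.1 hzE)
    · linarith
  have s2 : ∑ η ∈ F, (modeEnergy 𝒜 η d + modeEnergy 𝒜 η f)
      ≤ energyNormSq 𝒜 d + energyNormSq 𝒜 f := by
    rw [Finset.sum_add_distrib]
    exact add_le_add (sum_modeEnergy_le h hdE F) (sum_modeEnergy_le h H.forcing_mem F)
  have s3 := sum_modeEnergy_le h (waveOp_mem hz') F
  gcongr

/-! ### Uniform bounds and the difference inequality over double windows -/

theorem IsDampedSolution.norm_mid_le {τ : ℝ} (hτ : 0 < τ) {z zt : ℕ → X × X}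
    (H : IsDampedSolution 𝒜 𝓑 τ z zt) (k : ℕ) :
    ‖toEnergy 𝒜 (mid (z k) (zt (k + 1)))‖ ≤ ‖toEnergy 𝒜 (z k)‖ := by
  have S := H.step k
  have e := S.energy_eq h hτ
  rw [← S.viscosity_step.energy_eq h hτ, inner_toEnergy_ctrl, real_inner_self_eq_norm_sq] at e
  have h1 : ‖toEnergy 𝒜 (zt (k + 1))‖ ≤ ‖toEnergy 𝒜 (z k)‖ := by
    refine (sq_le_sq₀ (norm_nonneg _) (norm_nonneg _)).1 ?_
    rw [norm_toEnergy_sq, norm_toEnergy_sq, e]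
    have : 0 ≤ 2 * τ * ‖obs 𝓑 (mid (z k) (zt (k + 1)))‖ ^ 2 := by positivity
    linarith
  have hzt := S.mem_tilde hτ
  rw [mid, toEnergy_smul _ (Submodule.add_mem _ S.mem hzt), toEnergy_add S.mem hzt, norm_smul,
    Real.norm_of_nonneg (by norm_num)]
  linarith [norm_add_le (toEnergy 𝒜 (z k)) (toEnergy 𝒜 (zt (k + 1)))]

/-- The increment and the forcing of the damped scheme stay bounded by the norm of the initial state
in `D(A)`. -/
theorem exists_increment_bound (𝓑 : Y →L[ℝ] X) : ∃ K : ℝ, 0 < K ∧ ∀ τ : ℝ, 0 < τ → τ < 1 →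
    ∀ z zt : ℕ → X × X, IsDampedSolution 𝒜 𝓑 τ z zt → z 0 ∈ waveDomain 𝒜 → ∀ k : ℕ,
      4 * (energyNormSq 𝒜 (τ⁻¹ • (z (k + 1) - z k))
        + energyNormSq 𝒜 (ctrl 𝓑 (obs 𝓑 (mid (z k) (zt (k + 1)))))) ≤
      K * waveDomainNormSq 𝒜 (z 0) := by
  set κ := ((5 + 2 * ‖𝓑‖ ^ 2) * (1 + ‖𝓑‖ ^ 2 * (1 + ‖inverse h‖))) ^ 2
  refine ⟨4 * (κ + ‖𝓑‖ ^ 4 * ‖inverse h‖), by positivity, fun τ hτ hτ1 z zt H h0 k => ?_⟩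
  have b1 : energyNormSq 𝒜 (τ⁻¹ • (z (k + 1) - z k)) ≤ κ * waveDomainNormSq 𝒜 (z 0) := by
    rw [energyNormSq_smul _ (Submodule.sub_mem _ (H.mem _) (H.mem _)), inv_pow,
      inv_mul_le_iff₀ (by positivity), ← mul_assoc]
    exact (H.diff.antitone h hτ (Nat.zero_le k)).trans (H.energyNormSq_sub_le h hτ hτ1 h0)
  have b2 : energyNormSq 𝒜 (ctrl 𝓑 (obs 𝓑 (mid (z k) (zt (k + 1)))))
      ≤ ‖𝓑‖ ^ 4 * ‖inverse h‖ * waveDomainNormSq 𝒜 (z 0) := by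
    have c1 : ‖toEnergy 𝒜 (ctrl 𝓑 (obs 𝓑 (mid (z k) (zt (k + 1)))))‖ ^ 2
        ≤ (‖𝓑‖ ^ 2 * ‖toEnergy 𝒜 (z k)‖) ^ 2 := by
      refine pow_le_pow_left₀ (norm_nonneg _) ((norm_ctrl_obs_le _).trans ?_) 2
      gcongr
      exact H.norm_mid_le h hτ k
    rw [mul_pow, norm_toEnergy_sq, norm_toEnergy_sq, ← pow_mul] at c1
    have c2 := (H.antitone h hτ (Nat.zero_le k)).trans (energyNormSq_le_waveOp h h0)
    rw [waveDomainNormSq_eq, mul_assoc]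
    exact c1.trans (by gcongr)
  linarith

/-- The difference inequality for the energy of the damped scheme over two windows. -/
theorem exists_difference_inequality {T c β : ℝ} (hT : 0 < T) (hc : 0 < c) (hβ : -(1 / 2) < β)
    (hobs : ∀ τ : ℝ, 0 < τ → τ < 1 → ∀ u ut : ℕ → X × X,
      IsConservativeSolution 𝒜 τ u ut → u 0 ∈ waveDomain 𝒜 → WeakObservability 𝒜 𝓑 T c β τ u ut) :
    ∃ a : ℝ, 0 < a ∧ ∀ τ : ℝ, 0 < τ → τ < 1 → ∀ z zt : ℕ → X × X,
      IsDampedSolution 𝒜 𝓑 τ z zt → z 0 ∈ waveDomain 𝒜 → ∀ j : ℕ, ∀ R : ℝ, 0 < R →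
      energyNormSq 𝒜 (z (j + 2 * (⌊T / τ⌋₊ + 1))) ≤
        a * (R ^ (1 + 2 * β) + 1) *
          (energyNormSq 𝒜 (z j) - energyNormSq 𝒜 (z (j + 2 * (⌊T / τ⌋₊ + 1))))
        + a * waveDomainNormSq 𝒜 (z 0) / R := by
  obtain ⟨K, hK, hKb⟩ := exists_increment_bound h 𝓑
  set C := (2 + 2 * (T + 1) * ‖𝓑‖ ^ 2 + 2 * (T + 1) ^ 2 * ‖𝓑‖ ^ 4) / c with hC
  have hC0 : 0 < C := by positivity
  refine ⟨C + K + (2 * T)⁻¹, by positivity, fun τ hτ hτ1 z zt H h0 j R hR => ?_⟩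
  set N := ⌊T / τ⌋₊ + 1 with hN
  have hNτ : T ≤ N * τ := by
    have := (Nat.lt_floor_add_one (T / τ)).le
    rw [div_le_iff₀ hτ] at this
    rw [hN]
    push_cast
    exact this
  have hN0 : (0 : ℝ) < N := by
    rw [hN]
    positivity
  set E : ℕ → ℝ := fun k => energyNormSq 𝒜 (z k) with hE
  have hanti : Antitone E := H.antitone h hτ
  set D := waveDomainNormSq 𝒜 (z 0)
  have hD : 0 ≤ D := by
    rw [show D = _ from waveDomainNormSq_eq _]
    exact energyNormSq_nonneg _
  set δ := E j - E (j + 2 * N) with hδ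
  have hδ0 : 0 ≤ δ := sub_nonneg.2 (hanti (Nat.le_add_right _ _))
  -- Apply observability from each state `j + i + 1` with `i < N`. These windows end by `j + 2 * N`,
  -- which is why two window lengths are used.
  have hk : ∀ i ∈ Finset.range N, E (j + 2 * N) ≤
      (R ^ (1 + 2 * β) * (C * δ) + R⁻¹ * (K * D))
        + τ ^ 2 * energyNormSq 𝒜 (waveOp 𝒜 (z (j + i + 1))) := by
    intro i hi
    rw [Finset.mem_range] at hi
    have m1 : E (j + 2 * N) ≤ E (j + i + 1) := hanti (by omega)
    have m2 := (H.step (j + i)).energyNormSq_le h hβ hτ hR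
    have m3 := hKb τ hτ hτ1 z zt H h0 (j + i)
    have m4 := (H.shift (j + i + 1)).pairNormSq_le h hT hc hτ hτ1 (hobs τ hτ hτ1)
      (H.viscosity_step (j + i)).mem
    have m5 : E (j + i + 1) - E (j + i + 1 + N) ≤ δ :=
      sub_le_sub (hanti (by omega)) (hanti (by omega))
    have m6 : pairNormSq 𝒜 (-β) (-β - 1 / 2) (z (j + i + 1)) ≤ C * δ :=
      m4.trans (mul_le_mul_of_nonneg_left m5 hC0.le)
    refine (m1.trans m2).trans ?_
    gcongr
  have hsum := Finset.sum_le_sum hk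
  rw [Finset.sum_const, Finset.sum_add_distrib, Finset.sum_const, Finset.card_range, nsmul_eq_mul,
    nsmul_eq_mul, ← Finset.mul_sum] at hsum
  set V := ∑ i ∈ Finset.range N, energyNormSq 𝒜 (waveOp 𝒜 (z (j + i + 1))) with hV
  have hVδ : 2 * τ ^ 3 * V ≤ δ := by
    have tel := Finset.sum_range_sub' (fun i => E (j + i)) N
    have : 2 * τ ^ 3 * V ≤ ∑ i ∈ Finset.range N, (E (j + i) - E (j + (i + 1))) := by
      rw [hV, Finset.mul_sum]
      refine Finset.sum_le_sum fun i _ => ?_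
      have e := H.energy_eq h hτ (j + i)
      have p1 : 0 ≤ 2 * τ * ‖obs 𝓑 (mid (z (j + i)) (zt (j + i + 1)))‖ ^ 2 := by positivity
      have p2 := mul_nonneg (pow_pos hτ 6).le
        (energyNormSq_nonneg (𝒜 := 𝒜) (waveOp 𝒜 (waveOp 𝒜 (z (j + i + 1)))))
      simp only [hE, ← add_assoc]
      linarith
    rw [tel] at this
    have : E (j + 2 * N) ≤ E (j + N) := hanti (by omega)
    simp only [add_zero] at *
    linarith
  -- Dissipation gives `τ² V ≤ δ / (2τ)`, and `1/τ ≤ N / T`: averaged over `N` steps, the viscous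
  -- term costs at most `δ / (2T)`.
  have hVN : τ ^ 2 * V ≤ N * ((2 * T)⁻¹ * δ) := by
    have h1 : τ ^ 2 * V ≤ δ / (2 * τ) := by
      rw [le_div_iff₀ (by positivity)]
      linarith
    refine h1.trans ?_
    rw [← mul_assoc, div_eq_inv_mul]
    gcongr
    rw [mul_inv, mul_inv, mul_left_comm]
    gcongr
    rw [← div_eq_mul_inv, le_div_iff₀ hT, inv_mul_le_iff₀ hτ]
    linarith
  have hfin : E (j + 2 * N) ≤ R ^ (1 + 2 * β) * (C * δ) + R⁻¹ * (K * D) + (2 * T)⁻¹ * δ := by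
    refine le_of_mul_le_mul_left ?_ hN0
    linarith
  refine hfin.trans ?_
  have hRβ : 0 ≤ R ^ (1 + 2 * β) := Real.rpow_nonneg hR.le _
  have g1 : R⁻¹ * (K * D) ≤ (C + K + (2 * T)⁻¹) * D / R := by
    rw [div_eq_inv_mul]
    gcongr
    have : 0 < (2 * T)⁻¹ := by positivity
    linarith
  have g2 : R ^ (1 + 2 * β) * (C * δ) + (2 * T)⁻¹ * δ
      ≤ (C + K + (2 * T)⁻¹) * (R ^ (1 + 2 * β) + 1) * δ := by
    have : 0 < (2 * T)⁻¹ := by positivity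
    have : 0 ≤ (K + (2 * T)⁻¹) * R ^ (1 + 2 * β) * δ := by positivity
    have : 0 ≤ (C + K) * δ := by positivity
    linarith
  linarith

end

end ViscousScheme

/-! ### From double windows to all times -/

theorem theorem3p1 {X Y : Type*}
    [NormedAddCommGroup X] [InnerProductSpace ℝ X] [CompleteSpace X]
    [NormedAddCommGroup Y] [InnerProductSpace ℝ Y] [CompleteSpace Y]
    (𝒜 : X →ₗ.[ℝ] X) (h𝒜 : ViscousScheme.IsPositiveCompactInverse 𝒜) (𝓑 : Y →L[ℝ] X)
    (T c β : ℝ) (hT : 0 < T) (hc : 0 < c) (hβ : -(1 / 2) < β)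
    (hobs : ∀ τ : ℝ, 0 < τ → τ < 1 → ∀ u ut : ℕ → X × X,
      ViscousScheme.IsConservativeSolution 𝒜 τ u ut → u 0 ∈ ViscousScheme.waveDomain 𝒜 →
      ViscousScheme.WeakObservability 𝒜 𝓑 T c β τ u ut) :
    ∃ M : ℝ, 0 < M ∧ ∀ τ : ℝ, 0 < τ → τ < 1 → ∀ z zt : ℕ → X × X,
      ViscousScheme.IsDampedSolution 𝒜 𝓑 τ z zt → z 0 ∈ ViscousScheme.waveDomain 𝒜 →
      ∀ k : ℕ, ViscousScheme.energy 𝒜 (z k) ≤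
        M / (1 + (k : ℝ) * τ) ^ (1 / (1 + 2 * β)) * ViscousScheme.waveDomainNormSq 𝒜 (z 0) := by
  obtain ⟨a, ha, hdiff⟩ := ViscousScheme.exists_difference_inequality h𝒜 hT hc hβ hobs
  have hα : 0 < 1 + 2 * β := by linarith
  obtain ⟨M, hM, hdecay⟩ := ViscousScheme.exists_decay_constant hα ha
    (by positivity : 0 < ‖ViscousScheme.inverse h𝒜‖ + 1)
  -- Upper bound for the duration `n * τ` of a double window, uniform because `τ < 1`.
  set L := 2 * (T + 1) with hL
  refine ⟨1 / 2 * M * (1 + L) ^ (1 + 2 * β)⁻¹, by positivity, fun τ hτ hτ1 z zt H h0 k => ?_⟩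
  set D := ViscousScheme.waveDomainNormSq 𝒜 (z 0) with hD
  have hDeq : D = _ := ViscousScheme.waveDomainNormSq_eq (z 0)
  have hD0 : 0 ≤ D := hDeq ▸ ViscousScheme.energyNormSq_nonneg _
  set n := 2 * (⌊T / τ⌋₊ + 1) with hn
  have hanti := H.antitone h𝒜 hτ
  have hx := hdecay D (fun m => ViscousScheme.energyNormSq 𝒜 (z (m * n))) hD0
    (fun m => ViscousScheme.energyNormSq_nonneg _)
    (fun m m' hm => hanti (Nat.mul_le_mul_right n hm)) ?_ ?_ (k / n)
  · have hnτ : n * τ ≤ L := by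
      have := Nat.floor_le (div_nonneg hT.le hτ.le)
      rw [le_div_iff₀ hτ] at this
      rw [hn, hL]
      push_cast
      linarith
    have hk : (k : ℝ) ≤ ((k / n : ℕ) + 1) * n := by
      have : k < (k / n + 1) * n := by
        rw [mul_comm]
        exact Nat.lt_mul_div_succ k (by omega)
      exact_mod_cast this.le
    -- Time is comparable to the number of completed double windows; monotonicity of the energy
    -- handles the steps in between.
    have htime : 1 + k * τ ≤ (1 + L) * ((k / n : ℕ) + 1 : ℝ) := by
      have h1 : (k : ℝ) * τ ≤ ((k / n : ℕ) + 1) * L := by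
        calc (k : ℝ) * τ ≤ ((k / n : ℕ) + 1) * n * τ := by gcongr
          _ = ((k / n : ℕ) + 1) * (n * τ) := by ring
          _ ≤ _ := by gcongr
      have h2 : (0 : ℝ) ≤ (k / n : ℕ) := Nat.cast_nonneg _
      linarith
    have hpow : (1 + k * τ) ^ (1 + 2 * β)⁻¹
        ≤ (1 + L) ^ (1 + 2 * β)⁻¹ * ((k / n : ℕ) + 1 : ℝ) ^ (1 + 2 * β)⁻¹ := by
      rw [← Real.mul_rpow (by positivity) (by positivity)]
      gcongr
    have hE : ViscousScheme.energyNormSq 𝒜 (z k) ≤ M / ((k / n : ℕ) + 1 : ℝ) ^ (1 + 2 * β)⁻¹ * D :=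
      (hanti (Nat.div_mul_le_self k n)).trans hx
    have hle : M / ((k / n : ℕ) + 1 : ℝ) ^ (1 + 2 * β)⁻¹
        ≤ M * (1 + L) ^ (1 + 2 * β)⁻¹ / (1 + k * τ) ^ (1 + 2 * β)⁻¹ := by
      rw [div_le_div_iff₀ (by positivity) (by positivity), mul_assoc]
      gcongr
    rw [ViscousScheme.energy, one_div (1 + 2 * β), mul_assoc (1 / 2), mul_div_assoc (1 / 2),
      mul_assoc (1 / 2)]
    gcongr
    exact hE.trans (by gcongr)
  · simp only [zero_mul]
    refine (ViscousScheme.energyNormSq_le_waveOp h𝒜 h0).trans ?_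
    rw [← hDeq]
    linarith
  · intro m R hR
    have := hdiff τ hτ hτ1 z zt H h0 (m * n) R hR
    rwa [← Nat.succ_mul] at this
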